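/- **Conventions.** Let $\mathbb R^4_2$ be $\mathbb R^4$ with $\langle V,W\rangle=V^1W^1+V^2W^2-V^3W^3-V^4W^4$ and let $\mathrm{AdS}_3=\{V\in\mathbb R^4_2:\langle V,V\rangle=-1\}$, time-oriented by the vector field $V\mapsto(0,0,V^4,-V^3)$ (a timelike vector is future directed if its product with this field is negative). Let $\mathbb R^3_1$ be $\mathbb R^3$ with $\langle u,v\rangle=u^1v^1+u^2v^2-u^3v^3$, let $\mathbb H=\{V\in\mathbb R^3_1:\langle V,V\rangle=-\tfrac12,\ V^3>0\}$, and identify the Grassmannian $Gr_2^+(2,4)$ of oriented spacelike planes of $\mathbb R^4_2$ with $\mathbb H\times\mathbb H$, with the product metric and the complex structure $\mathscr J_{(P,Q)}(v,w)=(-jv,jw)$, where $jv=\sqrt2\,P\times v$, $jw=\sqrt2\,Q\times w$ and $u\times v=(u^2v^3-u^3v^2,\ u^3v^1-u^1v^3,\ -(u^1v^2-u^2v^1))$. On $\mathbb R^4$ put $$\omega^1_\pm=e_2\wedge e_3\pm e_4\wedge e_1,\qquad \omega^2_\pm=e_1\wedge e_3\pm e_2\wedge e_4,\qquad \omega^3_\pm=e_1\wedge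 e_2\pm e_3\wedge e_4 .$$ Let $F:M\to\mathrm{AdS}_3$ be a smooth spacelike immersion of a surface $M$, with induced Riemannian metric $g$ and future directed timelike unit normal $\nu$ (tangent to $\mathrm{AdS}_3$). Orient $M$ so that $(X,Y)$ is a positive basis of $T_pM$ iff $(dF(X),dF(Y),\nu(p),F(p))$ is a positive basis of $\mathbb R^4$. The Gauss map of $F$ is $\mathscr G_F=(\mathscr G_+,\mathscr G_-)$ with $\mathscr G_\pm^A=\frac1{\sqrt2}*(F^*\omega^A_\pm)$, $A=1,2,3$. The Weingarten map is $\mathscr W_F(X)=\nabla_X\nu$, regarded as a tangent vector of $M$. Its eigenvalues $\lambda_1,\lambda_2$ are the principal curvatures, and $\phi=\arctan\lambda_1+\arctan\lambda_2$. Finally $\sigma=\mathscr G_F^*\langle\cdot,\cdot\rangle_{Gr_2^+(2,4)}$, and $\nabla^\sigma$ is the gradient with respect to $\sigma$. **Lemma.** Let $T>0$ and let $F:M\times[0,T)\to\mathrm{AdS}_3$ be a smooth family of spacelike immersions of a surface $M$, with future directed timelike unit normals $\nu$. Then the Gauss maps form a smooth family $\mathscr G_F:M\times[0,T)\to\mathbb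 H\times\mathbb H=Gr_2^+(2,4)$, and the following hold. 1. If $\frac{\partial}{\partial t}F=f\nu$ with a smooth function $f:M\times[0,T)\to\mathbb R$, then $$\frac{\partial}{\partial t}\mathscr G_F=\left(\mathscr J\circ d\mathscr G_F+d\mathscr G_F\circ\mathscr W_F\right)\nabla^\sigma f\qquad\text{on } M\times[0,T).$$ 2. If $\frac{\partial}{\partial t}F=\phi\,\nu$, then $\phi$ is smooth and the Gauss maps move by the Lagrangian mean curvature flow up to a tangential term: for every $t\in[0,T)$ the map $\mathscr G_F(\cdot,t)$ is a Lagrangian immersion into $Gr_2^+(2,4)$ and $$\frac{\partial}{\partial t}\mathscr G_F=\vec H+d\mathscr G_F\left(\mathscr W_F\nabla^\sigma\phi\right),$$ where $\vec H$ is the mean curvature vector of $\mathscr G_F(\cdot,t)$, i.e. the trace with respect to $\sigma$ of its second fundamental form in $Gr_2^+(2,4)$. -/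

import Mathlib

open scoped Manifold ContDiff
open Set

noncomputable section

namespace AdSGauss

/-! ### Linear algebra of the model spaces -/

/-- The vector space `ℝ⁴` underlying `ℝ⁴₂` (coordinates `V¹, V², V³, V⁴` are `V 0, V 1, V 2, V 3`). -/
abbrev R42 := Fin 4 → ℝ

/-- The vector space `ℝ³` underlying Minkowski space `ℝ³₁`. -/
abbrev R31 := Fin 3 → ℝ

/-- The model of the tangent planes of a surface. -/
abbrev Plane := EuclideanSpace ℝ (Fin 2)

/-- The inner product of `ℝ⁴₂`, of signature `(2, 2)`. -/
def sca (V W : R42) : ℝ := V 0 * W 0 + V 1 * W 1 - V 2 * W 2 - V 3 * W 3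

/-- The inner product of Minkowski space `ℝ³₁`. -/
def mink (u v : R31) : ℝ := u 0 * v 0 + u 1 * v 1 - u 2 * v 2

/-- The anti-de Sitter space `AdS₃ = {V : ⟨V, V⟩ = -1}`. -/
def AdS3 : Set R42 := {V | sca V V = -1}

/-- The hyperbolic plane `{V : ⟨V, V⟩ = -1/2, V³ > 0}` in Minkowski space. -/
def Hyp : Set R31 := {V | mink V V = -(1 / 2) ∧ 0 < V 2}

/-- The Grassmannian `Gr₂⁺(2,4)` of oriented spacelike planes in `ℝ⁴₂`, in the form of the
product of two hyperbolic planes. -/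
def Gr : Set (R31 × R31) := Hyp ×ˢ Hyp

/-- The Kähler metric of `Gr₂⁺(2,4)` (product metric), on vectors of `ℝ³₁ × ℝ³₁`. -/
def grMetric (u v : R31 × R31) : ℝ := mink u.1 v.1 + mink u.2 v.2

/-- The Lorentzian vector product of Minkowski space. -/
def lorentzCross (u v : R31) : R31 :=
  ![u 1 * v 2 - u 2 * v 1, u 2 * v 0 - u 0 * v 2, -(u 0 * v 1 - u 1 * v 0)]

/-- The rotation by `+π/2` in the tangent plane of `Hyp` at `P`; at `P = (0, 0, 1/√2)` it sends
`(v₁, v₂, 0)` to `(-v₂, v₁, 0)`. -/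
def hypRot (P v : R31) : R31 := Real.sqrt 2 • lorentzCross P v

/-- The complex structure `J` of `Gr₂⁺(2,4)` at the point `P`, for which Gauss maps of spacelike
surfaces in `AdS₃` are Lagrangian. -/
def grJ (P u : R31 × R31) : R31 × R31 := (-hypRot P.1 u.1, hypRot P.2 u.2)

/-- The Kähler form `ω = ⟨J ·, ·⟩` of `Gr₂⁺(2,4)` at the point `P`. -/
def grKahler (P u v : R31 × R31) : ℝ := grMetric (grJ P u) v

/-- The orthogonal projection of `ℝ³₁ × ℝ³₁` onto the tangent space of `Gr₂⁺(2,4)` at `P`. -/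
def grTangentProj (P u : R31 × R31) : R31 × R31 :=
  (u.1 + (2 * mink P.1 u.1) • P.1, u.2 + (2 * mink P.2 u.2) • P.2)

/-- The elementary 2-form `e_i ∧ e_j` on `ℝ⁴`. -/
def wedge (i j : Fin 4) (V W : R42) : ℝ := V i * W j - V j * W i

/-- The symplectic forms `ω₊¹, ω₊², ω₊³`. -/
def omegaPlus : Fin 3 → R42 → R42 → ℝ :=
  ![fun V W => wedge 1 2 V W + wedge 3 0 V W,
    fun V W => wedge 0 2 V W + wedge 1 3 V W,
    fun V W => wedge 0 1 V W + wedge 2 3 V W]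

/-- The symplectic forms `ω₋¹, ω₋², ω₋³`. -/
def omegaMinus : Fin 3 → R42 → R42 → ℝ :=
  ![fun V W => wedge 1 2 V W - wedge 3 0 V W,
    fun V W => wedge 0 2 V W - wedge 1 3 V W,
    fun V W => wedge 0 1 V W - wedge 2 3 V W]

/-- The coordinate basis of a tangent plane. -/
def bas (i : Fin 2) : Plane := EuclideanSpace.single i 1

/-- The matrix `(B_ij)` of a bilinear form in the coordinate basis. -/
def coeff (B : Plane → Plane → ℝ) : Matrix (Fin 2) (Fin 2) ℝ :=
  Matrix.of fun i j => B (bas i) (bas j)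

/-- Raising an index: the vector `B^{kl} ℓ_l ∂_k`, i.e. for a nondegenerate symmetric bilinear form
`B` and a linear form `ℓ`, the vector `X` with `B(X, Y) = ℓ(Y)` for all `Y`. -/
def raise (B : Plane → Plane → ℝ) (ℓ : Plane → ℝ) : Plane :=
  ∑ k, ∑ l, ((coeff B)⁻¹ k l * ℓ (bas l)) • bas k

/-! ### Surfaces -/

variable {M : Type*} [TopologicalSpace M] [ChartedSpace (EuclideanSpace ℝ (Fin 2)) M]

/-- The differential at `p` of a map from a surface into a vector space. -/
def diff {V : Type*} [NormedAddCommGroup V] [NormedSpace ℝ V] (u : M → V) (p : M) :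
    Plane →L[ℝ] V :=
  mfderiv (𝓡 2) 𝓘(ℝ, V) u p

/-- The second partial derivative `∂_i ∂_j u` at `p`, in the preferred chart at `p`. -/
def diff2 {V : Type*} [NormedAddCommGroup V] [NormedSpace ℝ V] (u : M → V) (p : M)
    (i j : Fin 2) : V :=
  fderiv ℝ (fun y => fderiv ℝ (u ∘ (extChartAt (𝓡 2) p).symm) y (bas j))
    (extChartAt (𝓡 2) p p) (bas i)

/-- Smoothness of a time dependent map on `M × [0, T)`. -/
def SmoothFamily {V : Type*} [NormedAddCommGroup V] [NormedSpace ℝ V] (T : ℝ)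
    (u : M → ℝ → V) : Prop :=
  ContMDiffOn ((𝓡 2).prod 𝓘(ℝ, ℝ)) 𝓘(ℝ, V) ∞ (fun q : M × ℝ => u q.1 q.2) (univ ×ˢ Ico 0 T)

/-- The velocity at time `t ∈ [0, T)` of a curve defined on `[0, T)` is `v`. -/
def HasVelocity {V : Type*} [NormedAddCommGroup V] [NormedSpace ℝ V] (T : ℝ)
    (c : ℝ → V) (t : ℝ) (v : V) : Prop :=
  HasDerivWithinAt c v (Ico 0 T) t

/-- The first fundamental form `g` of `F : M → AdS₃` at `p`. -/
def firstForm (F : M → R42) (p : M) (X Y : Plane) : ℝ := sca (diff F p X) (diff F p Y)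

/-- A smooth family of spacelike immersions `M × [0, T) → AdS₃`. -/
structure SpacelikeFamily (T : ℝ) (F : M → ℝ → R42) : Prop where
  smooth : SmoothFamily T F
  mem_AdS3 : ∀ p, ∀ t ∈ Ico 0 T, F p t ∈ AdS3
  spacelike : ∀ p, ∀ t ∈ Ico 0 T, ∀ X : Plane, X ≠ 0 → 0 < firstForm (fun q => F q t) p X X

/-- The timelike vector field of `AdS₃` that defines its time orientation (it sends
`(0, 0, 0, 1)` to `(0, 0, 1, 0)`). -/
def timeField (V : R42) : R42 := ![0, 0, V 3, -V 2]

/-- `n` is the future directed timelike unit normal of `F : M → AdS₃` at `p`. -/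
structure IsFutureNormal (F : M → R42) (p : M) (n : R42) : Prop where
  tangent_AdS3 : sca n (F p) = 0
  normal : ∀ X : Plane, sca n (diff F p X) = 0
  unit : sca n n = -1
  future : sca n (timeField (F p)) < 0

/-- The sign of the coordinate basis of `T_pM`. A basis `X, Y` of `T_pM` is positive if
`dF(X), dF(Y), ν` is positive in `AdS₃`, that is, if `dF(X), dF(Y), ν, F(p)` is positive in `ℝ⁴`
(`F(p)` being the unit normal of `AdS₃` at `F(p)`). -/
def orientSign (F ν : M → R42) (p : M) : ℝ :=
  Real.sign (Matrix.det ![diff F p (bas 0), diff F p (bas 1), ν p, F p])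

/-- The Hodge star, with respect to the first fundamental form and the orientation of `M`, of a
2-form `α` on `T_pM`. -/
def hodge (F ν : M → R42) (p : M) (α : Plane → Plane → ℝ) : ℝ :=
  orientSign F ν p * α (bas 0) (bas 1) / Real.sqrt (coeff (firstForm F p)).det

/-- The Gauss map `(G₊, G₋) : M → ℍ² × ℍ²` of a spacelike surface with unit normal `ν`. -/
def gaussMap (F ν : M → R42) (p : M) : R31 × R31 :=
  (fun A => 1 / Real.sqrt 2 * hodge F ν p fun X Y => omegaPlus A (diff F p X) (diff F p Y),
   fun A => 1 / Real.sqrt 2 * hodge F ν p fun X Y => omegaMinus A (diff F p X) (diff F p Y))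

/-- The second fundamental form `h(X, Y) = g(∇_X ν, dF(Y))`. -/
def secondForm (F ν : M → R42) (p : M) (X Y : Plane) : ℝ := sca (diff ν p X) (diff F p Y)

/-- The Weingarten map `W X = ∇_X ν`, viewed as a vector of `T_pM`: `g(W X, Y) = h(X, Y)`. -/
def weingarten (F ν : M → R42) (p : M) (X : Plane) : Plane :=
  raise (firstForm F p) (secondForm F ν p X)

/-- The matrix `(h^k_i) = (g^{kl} h_{li})` of the Weingarten map. -/
def weingartenMatrix (F ν : M → R42) (p : M) : Matrix (Fin 2) (Fin 2) ℝ :=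
  (coeff (firstForm F p))⁻¹ * coeff (secondForm F ν p)

/-- The principal curvatures, i.e. the eigenvalues of the Weingarten map with multiplicity. -/
def principalCurvatures (F ν : M → R42) (p : M) : Multiset ℝ :=
  (weingartenMatrix F ν p).charpoly.roots

/-- The Lagrangian angle `φ = arctan λ₁ + arctan λ₂`. -/
def lagrangianAngle (F ν : M → R42) (p : M) : ℝ :=
  ((principalCurvatures F ν p).map Real.arctan).sum

/-! ### Surfaces in the Grassmannian -/

/-- The metric `σ` induced on `M` by `G : M → Gr₂⁺(2,4)`. -/
def inducedMetric (G : M → R31 × R31) (p : M) (X Y : Plane) : ℝ :=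
  grMetric (diff G p X) (diff G p Y)

/-- The gradient of `f` with respect to the metric induced by `G`. -/
def grad (G : M → R31 × R31) (f : M → ℝ) (p : M) : Plane :=
  raise (inducedMetric G p) (fun X => diff f p X)

/-- The component, normal to `G(M)` in `Gr₂⁺(2,4)`, of a vector `u` of `ℝ³₁ × ℝ³₁` at `G p`. -/
def normalPart (G : M → R31 × R31) (p : M) (u : R31 × R31) : R31 × R31 :=
  grTangentProj (G p) u -
    diff G p (raise (inducedMetric G p)
      (fun X => grMetric (grTangentProj (G p) u) (diff G p X)))

/-- The second fundamental form of `G : M → Gr₂⁺(2,4)` in the coordinate basis at `p`: the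
Levi-Civita connection of `Gr₂⁺(2,4)` being the tangential part of the flat one, it is the
component of `∂_i ∂_j G` tangent to `Gr₂⁺(2,4)` and normal to `G(M)`. -/
def grSecondForm (G : M → R31 × R31) (p : M) (i j : Fin 2) : R31 × R31 :=
  normalPart G p (diff2 G p i j)

/-- The mean curvature vector of `G : M → Gr₂⁺(2,4)`: the trace of its second fundamental form
with respect to the induced metric. -/
def meanCurvature (G : M → R31 × R31) (p : M) : R31 × R31 :=
  ∑ i, ∑ j, (coeff (inducedMetric G p))⁻¹ i j • grSecondForm G p i j

/-- `G : M → Gr₂⁺(2,4)` is a Lagrangian immersion. -/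
structure IsLagrangianImmersion (G : M → R31 × R31) : Prop where
  smooth : ContMDiff (𝓡 2) 𝓘(ℝ, R31 × R31) ∞ G
  mem_Gr : ∀ p, G p ∈ Gr
  immersion : ∀ p, Function.Injective (diff G p)
  lagrangian : ∀ p X Y, grKahler (G p) (diff G p X) (diff G p Y) = 0

end AdSGauss

end

/-! The oriented tangent plane of the surface and the plane spanned by `ν` and `F` are orthogonal
complements in `ℝ⁴₂`, so their bivectors are proportional in each of the two halves of `Λ²ℝ⁴`. With
the orientation fixed in the statement, the Gauss map is therefore `bivPair ν F` (`gaussMap_eq`),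
bilinear in `ν` and `F`. Everything reduces to differentiating a bilinear expression, and `dG(X) =
bivPair (dν X) F + bivPair ν (dF X)`.

On such vectors the complex structure replaces `(dν X, dF X)` by `(dF X, -dν X)` (`FirstJet.J_eq`).
Hence `σ = g + III`, and `G` is a Lagrangian immersion because the second fundamental form `h` is
symmetric.

For the evolution equation, `∂ₜF = fν` forces the tangential part of `∂ₜν` to be the `g`-gradient of
`f`. Since `σ(Z, Y) = g((1 + W²)Z, Y)`, this gradient is `Z + W²Z` with `Z` the `σ`-gradient.
Inserted into `∂ₜG = bivPair (∂ₜν) F`, it gives `J dG(Z) + dG(WZ)` (`FirstJet.variation`).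

For the mean curvature flow it remains to show `H = J dG(∇φ)`. As `G` is Lagrangian, `H` is
determined by its products with the vectors `J dG(e_k)`, and these are the `σ`-traces of the cubic
form `∇h`, totally symmetric by Codazzi. On the other side `φ = arg det(g + ih)`, so `dφ` is the
trace of `Re (g + ih)⁻¹` against `∇h`. Both agree because `Re (g + ih)⁻¹ = (g + h g⁻¹ h)⁻¹ = σ⁻¹`
(`inv_add_third_form`, `SecondJet.argDeriv_eq`, `SecondJet.meanCurvature_eq`).

The formula for `φ` also gives its smoothness at umbilics, where the single principal curvatures
need not be smooth. The smoothness of `ν` comes from an explicit vector product formula. The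
pointwise algebra is done on jets (`FirstJet`, `SecondJet`), and the calculus in a fixed chart times
`[0, T)`. -/

noncomputable section

namespace AdSGauss

/-! ### Algebra of bivectors -/

/-- The self-dual part of the bivector `V ∧ W`. -/
def bivPlus (V W : R42) : R31 := fun A => omegaPlus A V W

/-- The anti-self-dual part of the bivector `V ∧ W`. -/
def bivMinus (V W : R42) : R31 := fun A => omegaMinus A V W

/-- The determinant of four vectors. -/
def det4 (a b c d : R42) : ℝ := Matrix.det ![a, b, c, d]

/-- The normalized pair of self-dual and anti-self-dual parts of `V ∧ W`. -/
def bivPair (V W : R42) : R31 × R31 :=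
  ((1 / Real.sqrt 2) • bivPlus V W, (-(1 / Real.sqrt 2)) • bivMinus V W)

theorem det4_eq (a b c d : R42) : det4 a b c d =
    (a 0 * b 1 - a 1 * b 0) * (c 2 * d 3 - c 3 * d 2)
    - (a 0 * b 2 - a 2 * b 0) * (c 1 * d 3 - c 3 * d 1)
    + (a 0 * b 3 - a 3 * b 0) * (c 1 * d 2 - c 2 * d 1)
    + (a 1 * b 2 - a 2 * b 1) * (c 0 * d 3 - c 3 * d 0)
    - (a 1 * b 3 - a 3 * b 1) * (c 0 * d 2 - c 2 * d 0)
    + (a 2 * b 3 - a 3 * b 2) * (c 0 * d 1 - c 1 * d 0) := by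
  change Matrix.det (Matrix.of ![a, b, c, d]) = _
  simp [Matrix.det_succ_row_zero, Fin.sum_univ_succ, Fin.succAbove]
  ring

theorem bivPlus_eq (V W : R42) : bivPlus V W =
    ![V 1 * W 2 - V 2 * W 1 + (V 3 * W 0 - V 0 * W 3),
      V 0 * W 2 - V 2 * W 0 + (V 1 * W 3 - V 3 * W 1),
      V 0 * W 1 - V 1 * W 0 + (V 2 * W 3 - V 3 * W 2)] := by
  ext A; fin_cases A <;> rfl

theorem bivMinus_eq (V W : R42) : bivMinus V W =
    ![V 1 * W 2 - V 2 * W 1 - (V 3 * W 0 - V 0 * W 3),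
      V 0 * W 2 - V 2 * W 0 - (V 1 * W 3 - V 3 * W 1),
      V 0 * W 1 - V 1 * W 0 - (V 2 * W 3 - V 3 * W 2)] := by
  ext A; fin_cases A <;> rfl

/-- The Gram determinant and the wedge pairing are the two natural quadratic forms on `Λ²ℝ⁴`. They
enter with equal signs on one half and opposite signs on the other, so adding the halves isolates
the former and subtracting them the latter. -/
theorem mink_bivPlus (a b c d : R42) : mink (bivPlus a b) (bivPlus c d) =
    -(sca a c * sca b d - sca a d * sca b c) - det4 a b c d := by
  rw [det4_eq]; simp [mink, bivPlus_eq, sca]; ring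

theorem mink_bivMinus (a b c d : R42) : mink (bivMinus a b) (bivMinus c d) =
    -(sca a c * sca b d - sca a d * sca b c) + det4 a b c d := by
  rw [det4_eq]; simp [mink, bivMinus_eq, sca]; ring

/-- Up to normalization the right side is the bracket of `a ∧ b` and `c ∧ d` in `so(2,2)`, which
splits as `so(2,1) ⊕ so(2,1)`, with the Lorentzian vector product as the bracket on each summand. -/
theorem lorentzCross_bivPlus (a b c d : R42) :
    lorentzCross (bivPlus a b) (bivPlus c d) =
      sca b c • bivPlus a d - sca a c • bivPlus b d - sca b d • bivPlus a c
        + sca a d • bivPlus b c := by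
  ext A; fin_cases A <;> simp [lorentzCross, bivPlus_eq, sca] <;> ring

theorem lorentzCross_bivMinus (a b c d : R42) :
    lorentzCross (bivMinus a b) (bivMinus c d) =
      sca b c • bivMinus a d - sca a c • bivMinus b d - sca b d • bivMinus a c
        + sca a d • bivMinus b c := by
  ext A; fin_cases A <;> simp [lorentzCross, bivMinus_eq, sca] <;> ring

theorem one_div_sqrt_two_sq : (1 / Real.sqrt 2) * (1 / Real.sqrt 2) = 1 / 2 := by
  rw [div_mul_div_comm, Real.mul_self_sqrt (by norm_num)]; norm_num

theorem mink_smul_left (r : ℝ) (u v : R31) : mink (r • u) v = r * mink u v := by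
  simp [mink]; ring
theorem mink_smul_right (r : ℝ) (u v : R31) : mink u (r • v) = r * mink u v := by
  simp [mink]; ring
theorem mink_add_left (u u' v : R31) : mink (u + u') v = mink u v + mink u' v := by
  simp [mink]; ring
theorem mink_add_right (u v v' : R31) : mink u (v + v') = mink u v + mink u v' := by
  simp [mink]; ring
theorem sca_comm (u v : R42) : sca u v = sca v u := by
  simp [sca]; ring
theorem sca_add_left (u u' v : R42) : sca (u + u') v = sca u v + sca u' v := by
  simp [sca]; ring
theorem sca_add_right (u v v' : R42) : sca u (v + v') = sca u v + sca u v' := by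
  simp [sca]; ring
theorem sca_smul_left (r : ℝ) (u v : R42) : sca (r • u) v = r * sca u v := by
  simp [sca]; ring
theorem sca_smul_right (r : ℝ) (u v : R42) : sca u (r • v) = r * sca u v := by
  simp [sca]; ring

theorem lorentzCross_smul_smul (r s : ℝ) (u v : R31) :
    lorentzCross (r • u) (s • v) = (r * s) • lorentzCross u v := by
  ext A; fin_cases A <;> simp [lorentzCross] <;> ring

theorem lorentzCross_triple (u v : R31) :
    lorentzCross u (lorentzCross u v) = mink u u • v - mink u v • u := by
  ext A; fin_cases A <;> simp [lorentzCross, mink] <;> ring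

theorem grMetric_bivPair (a b c d : R42) : grMetric (bivPair a b) (bivPair c d) =
    -(sca a c * sca b d - sca a d * sca b c) := by
  simp only [grMetric, bivPair, mink_smul_left, mink_smul_right, mink_bivPlus, mink_bivMinus]
  linear_combination 2 * (-(sca a c * sca b d - sca a d * sca b c)) * one_div_sqrt_two_sq

/-- The second factor of `bivPair` carries a minus sign and enters twice on the left but once on the
right. This compensates the opposite signs of the two rotations in `grJ`, so one formula serves both
factors. -/
theorem grJ_bivPair (a b c d : R42) : grJ (bivPair a b) (bivPair c d) =
    -(sca b c • bivPair a d - sca a c • bivPair b d - sca b d • bivPair a c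
        + sca a d • bivPair b c) := by
  have h : Real.sqrt 2 * ((1 / Real.sqrt 2) * (1 / Real.sqrt 2)) = 1 / Real.sqrt 2 := by
    field_simp
  have h' : Real.sqrt 2 * (-(1 / Real.sqrt 2) * -(1 / Real.sqrt 2)) = 1 / Real.sqrt 2 := by
    rw [neg_mul_neg, h]
  simp only [grJ, hypRot, bivPair, lorentzCross_smul_smul, lorentzCross_bivPlus,
    lorentzCross_bivMinus, smul_smul, h, h']
  refine Prod.ext ?_ ?_
  · ext A; simp; ring
  · ext A; simp; ring

theorem bivPair_add_left (a b c : R42) : bivPair (a + b) c = bivPair a c + bivPair b c := by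
  refine Prod.ext ?_ ?_ <;> ext A <;> fin_cases A <;>
    simp [bivPair, bivPlus_eq, bivMinus_eq] <;> ring

theorem bivPair_smul_left (r : ℝ) (a c : R42) : bivPair (r • a) c = r • bivPair a c := by
  refine Prod.ext ?_ ?_ <;> ext A <;> fin_cases A <;>
    simp [bivPair, bivPlus_eq, bivMinus_eq] <;> ring

theorem bivPair_swap (a b : R42) : bivPair b a = -bivPair a b := by
  refine Prod.ext ?_ ?_ <;> ext A <;> fin_cases A <;>
    simp [bivPair, bivPlus_eq, bivMinus_eq] <;> ring

theorem bivPair_self (a : R42) : bivPair a a = 0 := by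
  refine Prod.ext ?_ ?_ <;> ext A <;> fin_cases A <;>
    simp [bivPair, bivPlus_eq, bivMinus_eq] <;> ring

theorem bivPair_add_right (a b c : R42) : bivPair a (b + c) = bivPair a b + bivPair a c := by
  rw [bivPair_swap, bivPair_add_left, bivPair_swap a b, bivPair_swap a c]; abel

theorem bivPair_smul_right (r : ℝ) (a c : R42) : bivPair a (r • c) = r • bivPair a c := by
  rw [bivPair_swap, bivPair_smul_left, bivPair_swap a c, smul_neg, neg_neg]

/-- `bivPair` as a continuous bilinear map. -/
def bivPairL : R42 →L[ℝ] R42 →L[ℝ] R31 × R31 :=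
  LinearMap.toContinuousLinearMap <| LinearMap.toContinuousLinearMap.toLinearMap ∘ₗ
    LinearMap.mk₂ ℝ bivPair bivPair_add_left bivPair_smul_left bivPair_add_right
      (fun r a c => bivPair_smul_right r a c)

/-- `sca` as a continuous bilinear map. -/
def scaL : R42 →L[ℝ] R42 →L[ℝ] ℝ :=
  LinearMap.toContinuousLinearMap <| LinearMap.toContinuousLinearMap.toLinearMap ∘ₗ
    LinearMap.mk₂ ℝ sca sca_add_left sca_smul_left sca_add_right
      (fun r a c => sca_smul_right r a c)

/-! ### Frames adapted to a spacelike plane -/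

theorem eq_smul_of_lorentzCross_eq_zero {u v : R31} (h : lorentzCross u v = 0)
    (hu : mink u u = -1) : v = (-mink u v) • u := by
  have h1 := lorentzCross_triple u v
  have h2 : lorentzCross u 0 = 0 := by ext A; fin_cases A <;> simp [lorentzCross]
  rw [h, h2, hu, neg_one_smul] at h1
  rw [neg_smul]
  exact (neg_eq_iff_eq_neg.1 (sub_eq_zero.1 h1.symm))

theorem det4_swap (a b c d : R42) : det4 c d a b = det4 a b c d := by
  rw [det4_eq, det4_eq]; ring

section Frame

variable {a b c d : R42}

/-- `c, d` are orthonormal timelike vectors, orthogonal to `a, b`. -/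
structure AdaptedFrame (a b c d : R42) : Prop where
  ac : sca a c = 0
  ad : sca a d = 0
  bc : sca b c = 0
  bd : sca b d = 0
  cc : sca c c = -1
  dd : sca d d = -1
  cd : sca c d = 0
  pos : 0 < sca a a * sca b b - sca a b * sca a b

/-- Rotations of orthogonal planes commute, so the vector product of the two bivectors vanishes, and
in `so(2,1)` only the multiples of a timelike element commute with it. This is the Hodge duality
that trades the tangent plane for the plane of `ν` and `F`. -/
theorem AdaptedFrame.bivPlus_eq (h : AdaptedFrame a b c d) :
    bivPlus a b = det4 a b c d • bivPlus c d := by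
  have h1 : lorentzCross (bivPlus c d) (bivPlus a b) = 0 := by
    rw [lorentzCross_bivPlus, sca_comm d a, sca_comm c a, sca_comm d b, sca_comm c b,
      h.ac, h.ad, h.bc, h.bd]; simp
  have h2 : mink (bivPlus c d) (bivPlus c d) = -1 := by
    rw [mink_bivPlus, sca_comm d c, h.cc, h.dd, h.cd, det4_eq]; ring
  rw [eq_smul_of_lorentzCross_eq_zero h1 h2, mink_bivPlus, sca_comm d a, sca_comm c a,
    sca_comm d b, sca_comm c b, h.ac, h.ad, h.bc, h.bd, det4_swap]
  simp

theorem AdaptedFrame.bivMinus_eq (h : AdaptedFrame a b c d) :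
    bivMinus a b = (-det4 a b c d) • bivMinus c d := by
  have h1 : lorentzCross (bivMinus c d) (bivMinus a b) = 0 := by
    rw [lorentzCross_bivMinus, sca_comm d a, sca_comm c a, sca_comm d b, sca_comm c b,
      h.ac, h.ad, h.bc, h.bd]; simp
  have h2 : mink (bivMinus c d) (bivMinus c d) = -1 := by
    rw [mink_bivMinus, sca_comm d c, h.cc, h.dd, h.cd, det4_eq]; ring
  rw [eq_smul_of_lorentzCross_eq_zero h1 h2, mink_bivMinus, sca_comm d a, sca_comm c a,
    sca_comm d b, sca_comm c b, h.ac, h.ad, h.bc, h.bd, det4_swap]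
  simp

/-- Compare the norms of the two sides of `AdaptedFrame.bivPlus_eq`. -/
theorem AdaptedFrame.det4_sq (h : AdaptedFrame a b c d) :
    det4 a b c d ^ 2 = sca a a * sca b b - sca a b * sca a b := by
  have h1 := mink_bivPlus a b a b
  have h2 := mink_bivPlus c d c d
  have z : ∀ a b : R42, det4 a b a b = 0 := fun a b => by rw [det4_eq]; ring
  rw [z, sca_comm d c, h.cc, h.dd, h.cd] at h2
  rw [z, h.bivPlus_eq, mink_smul_left, mink_smul_right, h2, sca_comm b a] at h1
  linarith

theorem AdaptedFrame.det4_ne_zero (h : AdaptedFrame a b c d) : det4 a b c d ≠ 0 := by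
  intro h0
  have := h.det4_sq
  have := h.pos
  rw [h0] at *
  linarith

/-- A vector orthogonal to an adapted frame vanishes. -/
theorem AdaptedFrame.eq_zero (h : AdaptedFrame a b c d) {v : R42} (ha : sca v a = 0)
    (hb : sca v b = 0) (hc : sca v c = 0) (hd : sca v d = 0) : v = 0 := by
  -- The signs in the vector absorb the signature, so the four orthogonality relations become one
  -- linear system with matrix of determinant `det4 a b c d`.
  have key : (Matrix.of ![a, b, c, d]).mulVec ![v 0, v 1, -v 2, -v 3] = 0 := by
    ext i
    fin_cases i
    · simp [Matrix.mulVec, dotProduct, Fin.sum_univ_four]; simp only [sca] at ha; linarith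
    · simp [Matrix.mulVec, dotProduct, Fin.sum_univ_four]; simp only [sca] at hb; linarith
    · simp [Matrix.mulVec, dotProduct, Fin.sum_univ_four]; simp only [sca] at hc; linarith
    · simp [Matrix.mulVec, dotProduct, Fin.sum_univ_four]; simp only [sca] at hd; linarith
  have h0 := Matrix.eq_zero_of_mulVec_eq_zero h.det4_ne_zero key
  ext i
  have := congrFun h0 i
  fin_cases i <;> simpa using this

end Frame

/-- Both third coordinates are positive multiples of a timelike minor plus or minus a spacelike
minor. Time orientation makes the timelike minor positive, and it dominates the spacelike one. -/
theorem bivPair_mem_Gr {n F : R42} (hn : sca n n = -1) (hF : sca F F = -1) (hnF : sca n F = 0)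
    (hfut : sca n (timeField F) < 0) : bivPair n F ∈ Gr := by
  have hm : mink (bivPlus n F) (bivPlus n F) = -1 := by
    rw [mink_bivPlus, sca_comm F n, hn, hF, hnF, det4_eq]; ring
  have hm' : mink (bivMinus n F) (bivMinus n F) = -1 := by
    rw [mink_bivMinus, sca_comm F n, hn, hF, hnF, det4_eq]; ring
  have hp : 0 < n 2 * F 3 - n 3 * F 2 := by
    simp [sca, timeField] at hfut; linarith
  -- By Lagrange's identity each squared minor is a Gram determinant. Orthonormality turns the
  -- timelike one into `(1 + A)(1 + B) - m²`, where the spacelike one is `AB - m²` with `A, B ≥ 0`.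
  have hlt : (n 0 * F 1 - n 1 * F 0) ^ 2 < (n 2 * F 3 - n 3 * F 2) ^ 2 := by
    simp only [sca] at hn hF hnF
    have e : (n 2 * F 3 - n 3 * F 2) ^ 2 = (n 2 * n 2 + n 3 * n 3) * (F 2 * F 2 + F 3 * F 3)
      - (n 2 * F 2 + n 3 * F 3) ^ 2 := by ring
    rw [e, show n 2 * n 2 + n 3 * n 3 = 1 + (n 0 * n 0 + n 1 * n 1) by linarith,
      show F 2 * F 2 + F 3 * F 3 = 1 + (F 0 * F 0 + F 1 * F 1) by linarith,
      show n 2 * F 2 + n 3 * F 3 = n 0 * F 0 + n 1 * F 1 by linarith]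
    nlinarith [mul_self_nonneg (n 0), mul_self_nonneg (n 1), mul_self_nonneg (F 0),
      mul_self_nonneg (F 1)]
  have hab := abs_lt.1 (abs_lt_of_sq_lt_sq hlt hp.le)
  have hs : 0 < 1 / Real.sqrt 2 := by positivity
  refine ⟨⟨?_, ?_⟩, ⟨?_, ?_⟩⟩
  · simp only [bivPair, mink_smul_left, mink_smul_right, hm]
    linear_combination -one_div_sqrt_two_sq
  · simp only [bivPair, bivPlus_eq]
    exact mul_pos hs (by simp; linarith)
  · simp only [bivPair, mink_smul_left, mink_smul_right, hm']
    linear_combination -one_div_sqrt_two_sq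
  · simp only [bivPair, bivMinus_eq]
    exact mul_pos_of_neg_of_neg (neg_neg_of_pos hs) (by simp; linarith)

/-! ### Raising indices -/

theorem plane_eq (X : Plane) : X = X 0 • bas 0 + X 1 • bas 1 := by
  ext i; fin_cases i <;> simp [bas]

theorem bas_zero_ne : bas 0 ≠ 0 := by
  intro h; have := congrArg (fun X : Plane => X 0) h; simp [bas] at this

theorem bas_one_ne : bas 1 ≠ 0 := by
  intro h; have := congrArg (fun X : Plane => X 1) h; simp [bas] at this

theorem det_coeff (B : Plane → Plane → ℝ) : (coeff B).det =
    B (bas 0) (bas 0) * B (bas 1) (bas 1) - B (bas 0) (bas 1) * B (bas 1) (bas 0) := by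
  rw [Matrix.det_fin_two]; rfl

theorem det_coeff_pos (B : Plane →L[ℝ] Plane →L[ℝ] ℝ) (hs : ∀ X Y, B X Y = B Y X)
    (hp : ∀ X, X ≠ 0 → 0 < B X X) : 0 < (coeff fun X Y => B X Y).det := by
  rw [det_coeff]
  have h1 := hp _ bas_one_ne
  -- The test vector is `B`-orthogonal to `bas 1`, and `B` takes the value `B (bas 1) (bas 1)` times
  -- the determinant on it.
  have h2 : 0 < B (B (bas 1) (bas 1) • bas 0 + (-B (bas 0) (bas 1)) • bas 1)
      (B (bas 1) (bas 1) • bas 0 + (-B (bas 0) (bas 1)) • bas 1) := by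
    refine hp _ fun h => ?_
    have := congrArg (fun X : Plane => X 0) h
    simp [bas] at this
    exact h1.ne' this
  simp only [map_add, map_smul, _root_.add_apply, _root_.smul_apply,
    smul_eq_mul] at h2
  rw [hs (bas 1) (bas 0)] at h2 ⊢
  refine pos_of_mul_pos_right (a := B (bas 1) (bas 1)) ?_ h1.le
  linarith

theorem raise_spec (B : Plane →L[ℝ] Plane →L[ℝ] ℝ) (hs : ∀ X Y, B X Y = B Y X)
    (hp : ∀ X, X ≠ 0 → 0 < B X X) (ℓ : Plane →L[ℝ] ℝ) (Y : Plane) :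
    B (raise (fun X Y => B X Y) fun X => ℓ X) Y = ℓ Y := by
  have hd := det_coeff_pos B hs hp
  have key : (coeff fun X Y => B X Y)⁻¹ * (coeff fun X Y => B X Y) = 1 :=
    Matrix.nonsing_inv_mul _ (isUnit_iff_ne_zero.2 hd.ne')
  have hb : ∀ j, B (raise (fun X Y => B X Y) fun X => ℓ X) (bas j) = ℓ (bas j) := by
    intro j
    have ht : ∀ i j, (coeff fun X Y => B X Y)⁻¹ i j = (coeff fun X Y => B X Y)⁻¹ j i := by
      have : (coeff fun X Y => B X Y).transpose = coeff fun X Y => B X Y := by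
        ext i j; exact hs _ _
      intro i j
      conv_lhs => rw [← this, ← Matrix.transpose_nonsing_inv]
      rfl
    have h1 : ∀ l, ∑ k, (coeff fun X Y => B X Y)⁻¹ k l * B (bas k) (bas j) =
        if l = j then 1 else 0 := by
      intro l
      have := congrFun (congrFun key l) j
      rw [Matrix.mul_apply, Matrix.one_apply] at this
      rw [← this]
      exact Finset.sum_congr rfl fun k _ => by rw [ht k l]; rfl
    simp only [raise, map_sum, map_smul, _root_.sum_apply,
      _root_.smul_apply, smul_eq_mul]
    rw [Finset.sum_comm]
    have h2 : ∀ l, ∑ k, (coeff fun X Y => B X Y)⁻¹ k l * ℓ (bas l) * B (bas k) (bas j) =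
        (if l = j then 1 else 0) * ℓ (bas l) := by
      intro l
      rw [← h1 l, Finset.sum_mul]
      exact Finset.sum_congr rfl fun k _ => by ring
    simp [h2]
  rw [plane_eq Y]
  simp only [map_add, map_smul, hb]

/-! ### First order algebra of a spacelike surface -/

theorem grMetric_add_left (u u' v : R31 × R31) :
    grMetric (u + u') v = grMetric u v + grMetric u' v := by
  simp [grMetric, mink]; ring
theorem grMetric_add_right (u v v' : R31 × R31) :
    grMetric u (v + v') = grMetric u v + grMetric u v' := by
  simp [grMetric, mink]; ring
theorem grMetric_smul_left (r : ℝ) (u v : R31 × R31) :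
    grMetric (r • u) v = r * grMetric u v := by
  simp [grMetric, mink]; ring
theorem grMetric_smul_right (r : ℝ) (u v : R31 × R31) :
    grMetric u (r • v) = r * grMetric u v := by
  simp [grMetric, mink]; ring
theorem grMetric_comm (u v : R31 × R31) : grMetric u v = grMetric v u := by
  simp [grMetric, mink]; ring

theorem grMetric_sub_left (u u' v : R31 × R31) :
    grMetric (u - u') v = grMetric u v - grMetric u' v := by
  simp [grMetric, mink]; ring

/-- `grMetric` as a continuous bilinear map. -/
def grMetricL : R31 × R31 →L[ℝ] R31 × R31 →L[ℝ] ℝ :=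
  LinearMap.toContinuousLinearMap <| LinearMap.toContinuousLinearMap.toLinearMap ∘ₗ
    LinearMap.mk₂ ℝ grMetric grMetric_add_left grMetric_smul_left grMetric_add_right
      (fun r a c => grMetric_smul_right r a c)

theorem grJ_add (P u v : R31 × R31) : grJ P (u + v) = grJ P u + grJ P v := by
  refine Prod.ext ?_ ?_ <;> ext A <;> fin_cases A <;>
    simp [grJ, hypRot, lorentzCross] <;> ring

theorem grJ_smul (P v : R31 × R31) (r : ℝ) : grJ P (r • v) = r • grJ P v := by
  refine Prod.ext ?_ ?_ <;> ext A <;> fin_cases A <;>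
    simp [grJ, hypRot, lorentzCross] <;> ring

/-- The first order data at a point of a spacelike surface in `AdS₃`: its position `F`, its unit
normal `n` and their differentials `a`, `b`. -/
structure FirstJet (F n : R42) (a b : Plane →L[ℝ] R42) : Prop where
  FF : sca F F = -1
  nn : sca n n = -1
  nF : sca n F = 0
  aF : ∀ X, sca (a X) F = 0
  an : ∀ X, sca (a X) n = 0
  bF : ∀ X, sca (b X) F = 0
  bn : ∀ X, sca (b X) n = 0
  pos : ∀ X, X ≠ 0 → 0 < sca (a X) (a X)
  symm : ∀ X Y, sca (b X) (a Y) = sca (b Y) (a X)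

/-- The Weingarten map determined by the differentials of the position and of the normal. -/
def jetShape (a b : Plane →L[ℝ] R42) (X : Plane) : Plane :=
  raise (fun X Y => sca (a X) (a Y)) (fun Y => sca (b X) (a Y))

theorem adaptedFrame_of {F n : R42} {a : Plane →L[ℝ] R42} (FF : sca F F = -1)
    (nn : sca n n = -1) (nF : sca n F = 0) (aF : ∀ X, sca (a X) F = 0)
    (an : ∀ X, sca (a X) n = 0) (pos : ∀ X, X ≠ 0 → 0 < sca (a X) (a X)) :
    AdaptedFrame (a (bas 0)) (a (bas 1)) n F where
  ac := an _
  ad := aF _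
  bc := an _
  bd := aF _
  cc := nn
  dd := FF
  cd := nF
  pos := by
    have := det_coeff_pos (scaL.bilinearComp a a) (fun _ _ => sca_comm _ _) pos
    rw [det_coeff] at this
    change 0 < _ - sca (a (bas 0)) (a (bas 1)) * sca (a (bas 1)) (a (bas 0)) at this
    rwa [sca_comm (a (bas 1)) (a (bas 0))] at this

theorem sca_raise {a : Plane →L[ℝ] R42} (pos : ∀ X, X ≠ 0 → 0 < sca (a X) (a X))
    (v : R42) (Y : Plane) :
    sca (a (raise (fun X Y => sca (a X) (a Y)) (fun Y => sca v (a Y)))) (a Y) = sca v (a Y) :=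
  raise_spec (scaL.bilinearComp a a) (fun _ _ => sca_comm _ _) pos ((scaL v).comp a) Y

namespace FirstJet

variable {F n : R42} {a b : Plane →L[ℝ] R42} {c : Plane →L[ℝ] R31 × R31}

theorem adaptedFrame (h : FirstJet F n a b) : AdaptedFrame (a (bas 0)) (a (bas 1)) n F :=
  adaptedFrame_of h.FF h.nn h.nF h.aF h.an h.pos

theorem ext (h : FirstJet F n a b) {v w : R42} (ha : ∀ X, sca v (a X) = sca w (a X))
    (hn : sca v n = sca w n) (hF : sca v F = sca w F) : v = w := by
  have e : ∀ u, sca (v + (-1 : ℝ) • w) u = sca v u - sca w u := fun u => by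
    rw [sca_add_left, sca_smul_left]; ring
  have := h.adaptedFrame.eq_zero (v := v + (-1 : ℝ) • w) (by rw [e, ha, sub_self])
    (by rw [e, ha, sub_self]) (by rw [e, hn, sub_self]) (by rw [e, hF, sub_self])
  rw [neg_one_smul] at this
  exact add_neg_eq_zero.1 this

theorem decomp (h : FirstJet F n a b) (v : R42) :
    ∃ X, v = a X + (-sca v n) • n + (-sca v F) • F := by
  refine ⟨raise (fun X Y => sca (a X) (a Y)) (fun Y => sca v (a Y)), h.ext ?_ ?_ ?_⟩
  · intro X
    rw [sca_add_left, sca_add_left, sca_raise h.pos, sca_smul_left, sca_smul_left,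
      sca_comm n, sca_comm F, h.an, h.aF]
    ring
  · rw [sca_add_left, sca_add_left, sca_smul_left, sca_smul_left, h.an, h.nn, sca_comm F, h.nF]
    ring
  · rw [sca_add_left, sca_add_left, sca_smul_left, sca_smul_left, h.aF, h.nF, h.FF]
    ring

/-- The derivative of the normal is orthogonal to `n` and `F`, so it equals its tangential part. -/
theorem shape (h : FirstJet F n a b) (X : Plane) : a (jetShape a b X) = b X :=
  h.ext (fun Y => sca_raise h.pos _ Y) (by rw [h.an, h.bn]) (by rw [h.aF, h.bF])

/-- `σ = g + III`. -/
theorem induced (h : FirstJet F n a b) (hc : ∀ X, c X = bivPair (b X) F + bivPair n (a X))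
    (X Y : Plane) : grMetric (c X) (c Y) = sca (a X) (a Y) + sca (b X) (b Y) := by
  simp only [hc, grMetric_add_left, grMetric_add_right, grMetric_bivPair, h.FF, h.nn,
    h.nF, h.aF, h.bF, h.an, h.bn, sca_comm F, sca_comm n (a _), sca_comm n (b _)]
  ring

/-- Bracketing with `n ∧ F` is a quarter turn in the plane of `n` and `F`. The Lagrangian property
and the role of `J ∘ c` as a frame of the normal space are read off from this. -/
theorem J_eq (h : FirstJet F n a b) (hc : ∀ X, c X = bivPair (b X) F + bivPair n (a X))
    (X : Plane) : grJ (bivPair n F) (c X) = bivPair (a X) F + (-1 : ℝ) • bivPair n (b X) := by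
  rw [hc, grJ_add, grJ_bivPair, grJ_bivPair, h.nF, h.nn, h.FF, sca_comm F n, h.nF,
    sca_comm F, h.bF, sca_comm F, h.aF, sca_comm n, h.bn, sca_comm n, h.an,
    bivPair_swap F (a X)]
  module

theorem lagrangian (h : FirstJet F n a b) (hc : ∀ X, c X = bivPair (b X) F + bivPair n (a X))
    (X Y : Plane) : grMetric (grJ (bivPair n F) (c X)) (c Y) = 0 := by
  rw [h.J_eq hc, hc]
  simp only [grMetric_add_left, grMetric_add_right, grMetric_smul_left, grMetric_bivPair, h.FF,
    h.nn, h.nF, h.aF, h.bF, h.an, h.bn, sca_comm F, sca_comm n (a _), sca_comm n (b _)]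
  rw [sca_comm (a X), h.symm Y X]
  ring

theorem J_isometry (h : FirstJet F n a b) (hc : ∀ X, c X = bivPair (b X) F + bivPair n (a X))
    (X Y : Plane) : grMetric (grJ (bivPair n F) (c X)) (grJ (bivPair n F) (c Y)) =
      grMetric (c X) (c Y) := by
  rw [h.induced hc, h.J_eq hc, h.J_eq hc]
  simp only [grMetric_add_left, grMetric_add_right, grMetric_smul_left, grMetric_smul_right,
    grMetric_bivPair, h.FF,
    h.nn, h.nF, h.aF, h.bF, h.an, h.bn, sca_comm F, sca_comm n (a _), sca_comm n (b _)]
  ring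

/-- By `shape`, `b X` lies in the spacelike tangent plane. -/
theorem third_nonneg (h : FirstJet F n a b) (X : Plane) : 0 ≤ sca (b X) (b X) := by
  rw [← h.shape X]
  by_cases h0 : jetShape a b X = 0
  · simp [h0, sca]
  · exact (h.pos _ h0).le

theorem induced_pos (h : FirstJet F n a b) (hc : ∀ X, c X = bivPair (b X) F + bivPair n (a X))
    (X : Plane) (hX : X ≠ 0) : 0 < grMetric (c X) (c X) := by
  rw [h.induced hc]
  exact add_pos_of_pos_of_nonneg (h.pos X hX) (h.third_nonneg X)

theorem induced_raise (h : FirstJet F n a b)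
    (hc : ∀ X, c X = bivPair (b X) F + bivPair n (a X)) (ℓ : Plane →L[ℝ] ℝ) (Y : Plane) :
    grMetric (c (raise (fun X Y => grMetric (c X) (c Y)) fun X => ℓ X)) (c Y) = ℓ Y :=
  raise_spec (grMetricL.bilinearComp c c) (fun _ _ => grMetric_comm _ _) (h.induced_pos hc) ℓ Y

/-- The evolution of the Gauss map in terms of the variation `dn` of the normal. -/
theorem variation (h : FirstJet F n a b) (hc : ∀ X, c X = bivPair (b X) F + bivPair n (a X))
    (ℓ : Plane →L[ℝ] ℝ) {dn : R42} {f : ℝ} (hF : sca dn F = f) (hn : sca dn n = 0)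
    (ha : ∀ X, sca dn (a X) = ℓ X) :
    bivPair dn F + bivPair n (f • n) =
      grJ (bivPair n F) (c (raise (fun X Y => grMetric (c X) (c Y)) fun X => ℓ X)) +
      c (jetShape a b (raise (fun X Y => grMetric (c X) (c Y)) fun X => ℓ X)) := by
  have hZ := h.induced_raise hc ℓ
  set Z := raise (fun X Y => grMetric (c X) (c Y)) fun X => ℓ X
  -- The tangential part of `dn` is the `g`-gradient of `f`, rewritten as `Z + W²Z` through `σ = g +
  -- III`. The coefficient of `F` is `-f` because `F` has square `-1`, and this term dies in
  -- `bivPair F F = 0`.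
  have hdn : dn = a Z + b (jetShape a b Z) + (-f) • F := by
    refine h.ext (fun Y => ?_) ?_ ?_
    · rw [sca_add_left, sca_add_left, sca_smul_left, sca_comm F, h.aF, ha, ← hZ, h.induced hc,
        h.symm _ Y, h.shape, sca_comm (b Y)]
      ring
    · rw [sca_add_left, sca_add_left, sca_smul_left, h.an, h.bn, hn, sca_comm F, h.nF]; ring
    · rw [sca_add_left, sca_add_left, sca_smul_left, h.aF, h.bF, hF, h.FF]; ring
  rw [h.J_eq hc, hc, h.shape, hdn, bivPair_add_left, bivPair_add_left, bivPair_smul_left,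
    bivPair_smul_right, bivPair_self, bivPair_self]
  module

end FirstJet

/-! ### Second order algebra of a spacelike surface -/

theorem grTangentProj_add (P u v : R31 × R31) :
    grTangentProj P (u + v) = grTangentProj P u + grTangentProj P v := by
  refine Prod.ext ?_ ?_ <;> ext A <;> fin_cases A <;>
    simp [grTangentProj, mink] <;> ring

theorem grTangentProj_smul (P v : R31 × R31) (r : ℝ) :
    grTangentProj P (r • v) = r • grTangentProj P v := by
  refine Prod.ext ?_ ?_ <;> ext A <;> fin_cases A <;>
    simp [grTangentProj, mink] <;> ring

theorem grTangentProj_of_mink {P u : R31 × R31} (h1 : mink P.1 u.1 = 0) (h2 : mink P.2 u.2 = 0) :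
    grTangentProj P u = u := by
  simp [grTangentProj, h1, h2]

theorem grMetric_grTangentProj {P u v : R31 × R31} (h1 : mink P.1 v.1 = 0)
    (h2 : mink P.2 v.2 = 0) : grMetric (grTangentProj P u) v = grMetric u v := by
  simp [grMetric, grTangentProj, mink_add_left, mink_smul_left, h1, h2]

theorem mink_bivPair_fst (x y u v : R42) : mink (bivPair x y).1 (bivPair u v).1 =
    (1 / 2) * (-(sca x u * sca y v - sca x v * sca y u) - det4 x y u v) := by
  simp only [bivPair, mink_smul_left, mink_smul_right, mink_bivPlus]
  rw [← one_div_sqrt_two_sq]; ring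

theorem mink_bivPair_snd (x y u v : R42) : mink (bivPair x y).2 (bivPair u v).2 =
    (1 / 2) * (-(sca x u * sca y v - sca x v * sca y u) + det4 x y u v) := by
  simp only [bivPair, mink_smul_left, mink_smul_right, mink_bivMinus]
  rw [← one_div_sqrt_two_sq]; ring

namespace FirstJet

variable {F n : R42} {a b : Plane →L[ℝ] R42} {c : Plane →L[ℝ] R31 × R31}

theorem mink_right (h : FirstJet F n a b) (X : Plane) :
    mink (bivPair n F).1 (bivPair (a X) F).1 = 0 ∧
    mink (bivPair n F).2 (bivPair (a X) F).2 = 0 := by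
  rw [mink_bivPair_fst, mink_bivPair_snd, sca_comm n (a X), sca_comm F (a X), h.an, h.aF, det4_eq]
  constructor <;> ring

theorem mink_left (h : FirstJet F n a b) (X : Plane) :
    mink (bivPair n F).1 (bivPair n (a X)).1 = 0 ∧
    mink (bivPair n F).2 (bivPair n (a X)).2 = 0 := by
  rw [mink_bivPair_fst, mink_bivPair_snd, sca_comm n (a X), sca_comm F (a X), h.an, h.aF, det4_eq]
  constructor <;> ring

theorem proj_right (h : FirstJet F n a b) (X : Plane) :
    grTangentProj (bivPair n F) (bivPair (a X) F) = bivPair (a X) F :=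
  grTangentProj_of_mink (h.mink_right X).1 (h.mink_right X).2

theorem proj_left (h : FirstJet F n a b) (X : Plane) :
    grTangentProj (bivPair n F) (bivPair n (a X)) = bivPair n (a X) :=
  grTangentProj_of_mink (h.mink_left X).1 (h.mink_left X).2

theorem mink_fst (h : FirstJet F n a b) :
    mink (bivPair n F).1 (bivPair n F).1 = -(1 / 2) := by
  rw [mink_bivPair_fst, sca_comm F n, h.nn, h.FF, h.nF, det4_eq]; ring

theorem mink_snd (h : FirstJet F n a b) :
    mink (bivPair n F).2 (bivPair n F).2 = -(1 / 2) := by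
  rw [mink_bivPair_snd, sca_comm F n, h.nn, h.FF, h.nF, det4_eq]; ring

theorem proj_self (h : FirstJet F n a b) :
    grTangentProj (bivPair n F) (bivPair n F) = 0 := by
  rw [grTangentProj, h.mink_fst, h.mink_snd]
  refine Prod.ext ?_ ?_ <;> simp

/-- By duality each factor of a bivector of the tangent plane is a multiple of the corresponding
factor of the position `bivPair n F`, hence normal to its hyperbolic plane. This removes the mixed
terms from the second derivatives of the Gauss map. -/
theorem proj_tangent (h : FirstJet F n a b) (X Y : Plane) :
    grTangentProj (bivPair n F) (bivPair (a X) (a Y)) = 0 := by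
  have h0 : grTangentProj (bivPair n F) (bivPair (a (bas 0)) (a (bas 1))) = 0 := by
    have e : bivPair (a (bas 0)) (a (bas 1)) =
        (det4 (a (bas 0)) (a (bas 1)) n F • (bivPair n F).1,
          (-det4 (a (bas 0)) (a (bas 1)) n F) • (bivPair n F).2) := by
      rw [bivPair, h.adaptedFrame.bivPlus_eq, h.adaptedFrame.bivMinus_eq, bivPair,
        smul_comm, smul_comm (-(1 / Real.sqrt 2))]
    rw [e, grTangentProj, mink_smul_right, mink_smul_right, h.mink_fst, h.mink_snd]
    refine Prod.ext ?_ ?_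
    · simp; module
    · simp; module
  have e : bivPair (a X) (a Y) = (X 0 * Y 1 - X 1 * Y 0) • bivPair (a (bas 0)) (a (bas 1)) := by
    conv_lhs => rw [plane_eq X, plane_eq Y]
    simp only [map_add, map_smul, bivPair_add_left, bivPair_add_right, bivPair_smul_left,
      bivPair_smul_right, bivPair_self]
    rw [bivPair_swap (a (bas 0)) (a (bas 1))]
    module
  rw [e, grTangentProj_smul, h0, smul_zero]

/-- Every combination of `bivPair (a X) F` and `bivPair n (a Y)` that is orthogonal to the image of
`c` and of `J ∘ c` vanishes. -/
theorem eq_zero_of_orthogonal (h : FirstJet F n a b)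
    (hc : ∀ X, c X = bivPair (b X) F + bivPair n (a X)) {w : R31 × R31}
    (hw : ∃ X Y, w = bivPair (a X) F + bivPair n (a Y)) (h1 : ∀ V, grMetric w (c V) = 0)
    (h2 : ∀ V, grMetric w (grJ (bivPair n F) (c V)) = 0) : w = 0 := by
  obtain ⟨X, Y, rfl⟩ := hw
  simp only [h.J_eq hc] at h2
  simp only [hc] at h1
  simp only [grMetric_add_left, grMetric_add_right, grMetric_smul_right, grMetric_bivPair, h.FF,
    h.nn, h.nF, h.aF, h.bF, h.an, h.bn, sca_comm F, sca_comm n (a _), sca_comm n (b _)] at h1 h2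
  -- Testing against `J ∘ c` gives `a X = b Y`, testing against `c` gives `a Y = -b X`. Pairing the
  -- latter with `a Y` and using the symmetry of `h` yields `g(Y, Y) + III(Y, Y) = 0`, so `Y = 0`.
  have e1 : a X = b Y := by
    refine h.ext (fun V => ?_) (by rw [h.an, h.bn]) (by rw [h.aF, h.bF])
    rw [h.symm Y V, sca_comm (b V)]
    linarith [h2 V]
  have e2 : a Y + b X = 0 := by
    refine h.ext (fun V => ?_) ?_ ?_
    · rw [sca_add_left, h.symm X V, sca_comm (b V)]
      have : sca 0 (a V) = 0 := by simp [sca]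
      rw [this]
      linarith [h1 V]
    · rw [sca_add_left, h.an, h.bn]; simp [sca]
    · rw [sca_add_left, h.aF, h.bF]; simp [sca]
  have e3 : Y = 0 := by
    by_contra hY
    have h3 := h.pos Y hY
    have h4 : sca (a Y) (a Y) + sca (b X) (a Y) = 0 := by
      rw [← sca_add_left, e2]; simp [sca]
    rw [h.symm X Y, e1] at h4
    linarith [h.third_nonneg Y]
  rw [e3, map_zero] at e1
  have e4 : bivPair 0 F = 0 := by simpa using bivPair_smul_left 0 0 F
  have e5 : bivPair n 0 = 0 := by simpa using bivPair_smul_right 0 n 0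
  rw [e3, e1, map_zero, e4, e5, add_zero]

end FirstJet

/-- The real part of `det (g + i h)`. -/
def angleRe (a₀ a₁ b₀ b₁ : R42) : ℝ :=
  sca a₀ a₀ * sca a₁ a₁ - sca a₀ a₁ ^ 2 - (sca b₀ a₀ * sca b₁ a₁ - sca b₀ a₁ ^ 2)

/-- The imaginary part of `det (g + i h)`. -/
def angleIm (a₀ a₁ b₀ b₁ : R42) : ℝ :=
  sca a₀ a₀ * sca b₁ a₁ + sca a₁ a₁ * sca b₀ a₀ - 2 * (sca a₀ a₁ * sca b₀ a₁)

/-- The second order data at a point of a spacelike surface in `AdS₃`: the second derivatives of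
the position and of the normal, which satisfy the Codazzi equation. -/
structure SecondJet (F n : R42) (a b : Plane →L[ℝ] R42) (F₂ n₂ : Fin 2 → Fin 2 → R42) : Prop
    extends FirstJet F n a b where
  symmF : ∀ i j, F₂ i j = F₂ j i
  symmn : ∀ i j, n₂ i j = n₂ j i
  codazzi : ∀ i j k, sca (n₂ i j) (a (bas k)) + sca (b (bas j)) (F₂ i k) =
    sca (n₂ i k) (a (bas j)) + sca (b (bas k)) (F₂ i j)

/-- The derivative of the second fundamental form. -/
def cubicForm (a b : Plane →L[ℝ] R42) (F₂ n₂ : Fin 2 → Fin 2 → R42) (i j k : Fin 2) : ℝ :=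
  sca (n₂ i j) (a (bas k)) - sca (F₂ i j) (b (bas k))

/-- The derivative of `arg (x + i y)`. -/
def argDeriv (x y dx dy : ℝ) : ℝ := (dy * x - dx * y) / (x ^ 2 + y ^ 2)

/-- The derivative of `angleRe` in the direction `k`. -/
def dAngleRe (a b : Plane →L[ℝ] R42) (F₂ n₂ : Fin 2 → Fin 2 → R42) (k : Fin 2) : ℝ :=
  let g i j := sca (a (bas i)) (a (bas j))
  let h i j := sca (b (bas i)) (a (bas j))
  let dg i j := sca (F₂ k i) (a (bas j)) + sca (a (bas i)) (F₂ k j)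
  let dh i j := sca (n₂ k i) (a (bas j)) + sca (b (bas i)) (F₂ k j)
  dg 0 0 * g 1 1 + g 0 0 * dg 1 1 - 2 * g 0 1 * dg 0 1 -
    (dh 0 0 * h 1 1 + h 0 0 * dh 1 1 - 2 * h 0 1 * dh 0 1)

/-- The derivative of `angleIm` in the direction `k`. -/
def dAngleIm (a b : Plane →L[ℝ] R42) (F₂ n₂ : Fin 2 → Fin 2 → R42) (k : Fin 2) : ℝ :=
  let g i j := sca (a (bas i)) (a (bas j))
  let h i j := sca (b (bas i)) (a (bas j))
  let dg i j := sca (F₂ k i) (a (bas j)) + sca (a (bas i)) (F₂ k j)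
  let dh i j := sca (n₂ k i) (a (bas j)) + sca (b (bas i)) (F₂ k j)
  dg 0 0 * h 1 1 + g 0 0 * dh 1 1 + (dg 1 1 * h 0 0 + g 1 1 * dh 0 0) -
    2 * (dg 0 1 * h 0 1 + g 0 1 * dh 0 1)

/-- The principal curvatures are real. -/
theorem FirstJet.discrim_nonneg {F n : R42} {a b : Plane →L[ℝ] R42} (h : FirstJet F n a b) :
    4 * ((sca (a (bas 0)) (a (bas 0)) * sca (a (bas 1)) (a (bas 1)) -
        sca (a (bas 0)) (a (bas 1)) ^ 2) *
      (sca (b (bas 0)) (a (bas 0)) * sca (b (bas 1)) (a (bas 1)) -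
        sca (b (bas 0)) (a (bas 1)) ^ 2)) ≤
      angleIm (a (bas 0)) (a (bas 1)) (b (bas 0)) (b (bas 1)) ^ 2 := by
  have hp := h.adaptedFrame.pos
  have hE := h.pos _ bas_zero_ne
  simp only [angleIm]
  generalize sca (a (bas 0)) (a (bas 0)) = g00 at *
  generalize sca (a (bas 1)) (a (bas 1)) = g11 at *
  generalize sca (a (bas 0)) (a (bas 1)) = g01 at *
  generalize sca (b (bas 0)) (a (bas 0)) = h00 at *
  generalize sca (b (bas 1)) (a (bas 1)) = h11 at *
  generalize sca (b (bas 0)) (a (bas 1)) = h01 at *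
  -- Multiplied by `g00²`, the discriminant is a square plus `4 det g` times a square, so no
  -- diagonalization is needed.
  have h1 : 0 ≤ g00 ^ 2 * ((g00 * h11 + g11 * h00 - 2 * (g01 * h01)) ^ 2 -
      4 * ((g00 * g11 - g01 ^ 2) * (h00 * h11 - h01 ^ 2))) := by
    have : 0 ≤ (g00 * (g00 * h11 - g11 * h00) - 2 * g01 * (g00 * h01 - g01 * h00)) ^ 2 +
        4 * ((g00 * g11 - g01 * g01) * (g00 * h01 - g01 * h00) ^ 2) :=
      add_nonneg (sq_nonneg _) (mul_nonneg (by norm_num) (mul_nonneg hp.le (sq_nonneg _)))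
    linarith
  have := nonneg_of_mul_nonneg_right h1 (by positivity)
  linarith

/-- If the real part vanishes then `det h = det g`, and the discriminant bound makes the square of
the imaginary part at least `4 (det g)²`. -/
theorem FirstJet.angle_sq_pos {F n : R42} {a b : Plane →L[ℝ] R42} (h : FirstJet F n a b) :
    0 < angleRe (a (bas 0)) (a (bas 1)) (b (bas 0)) (b (bas 1)) ^ 2 +
      angleIm (a (bas 0)) (a (bas 1)) (b (bas 0)) (b (bas 1)) ^ 2 := by
  by_contra h0
  have hx := sq_nonneg (angleRe (a (bas 0)) (a (bas 1)) (b (bas 0)) (b (bas 1)))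
  have hy := sq_nonneg (angleIm (a (bas 0)) (a (bas 1)) (b (bas 0)) (b (bas 1)))
  have hx0 : angleRe (a (bas 0)) (a (bas 1)) (b (bas 0)) (b (bas 1)) = 0 :=
    pow_eq_zero_iff (two_ne_zero) |>.1 (by linarith)
  have hd := h.discrim_nonneg
  have hp := h.adaptedFrame.pos
  rw [angleRe, sub_eq_zero] at hx0
  rw [← hx0] at hd
  have := mul_pos hp hp
  rw [← sq (sca (a (bas 0)) (a (bas 1)))] at this
  linarith

/-- With `w = h g⁻¹` the matrix is `g + h g⁻¹ h`, whose inverse is the real part of `(g + ih)⁻¹`.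
The right side is that real part, written as `Re ((x - iy)(adj g + i adj h)) / (x² + y²)`. -/
theorem inv_add_third_form {g00 g01 g11 h00 h01 h11 w00 w01 w10 w11 x y : ℝ}
    (hg : g00 * g11 - g01 * g01 ≠ 0)
    (hx : x = g00 * g11 - g01 ^ 2 - (h00 * h11 - h01 ^ 2))
    (hy : y = g00 * h11 + g11 * h00 - 2 * (g01 * h01)) (hxy : x ^ 2 + y ^ 2 ≠ 0)
    (e00 : h00 = w00 * g00 + w01 * g01) (e01 : h01 = w00 * g01 + w01 * g11)
    (e10 : h01 = w10 * g00 + w11 * g01) (e11 : h11 = w10 * g01 + w11 * g11) :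
    (!![g00 + (w00 * h00 + w01 * h01), g01 + (w00 * h01 + w01 * h11);
        g01 + (w10 * h00 + w11 * h01), g11 + (w10 * h01 + w11 * h11)] :
          Matrix (Fin 2) (Fin 2) ℝ)⁻¹ =
      (x ^ 2 + y ^ 2)⁻¹ • (x • !![g11, -g01; -g01, g00] + y • !![h11, -h01; -h01, h00]) := by
  refine Matrix.inv_eq_left_inv ?_
  rw [Matrix.smul_mul, inv_smul_eq_iff₀ hxy]
  -- Cramer's rule eliminates `w` at the cost of a factor `det g`, which is cancelled at the end.
  have f00 : w00 * (g00 * g11 - g01 * g01) = h00 * g11 - h01 * g01 := by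
    linear_combination -g11 * e00 + g01 * e01
  have f01 : w01 * (g00 * g11 - g01 * g01) = h01 * g00 - h00 * g01 := by
    linear_combination -g00 * e01 + g01 * e00
  have f10 : w10 * (g00 * g11 - g01 * g01) = h01 * g11 - h11 * g01 := by
    linear_combination -g11 * e10 + g01 * e11
  have f11 : w11 * (g00 * g11 - g01 * g01) = h11 * g00 - h01 * g01 := by
    linear_combination -g00 * e11 + g01 * e10
  have s00 : (w00 * h00 + w01 * h01) * (g00 * g11 - g01 * g01) =
      h00 ^ 2 * g11 - 2 * h00 * h01 * g01 + h01 ^ 2 * g00 := by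
    linear_combination h00 * f00 + h01 * f01
  have s01 : (w00 * h01 + w01 * h11) * (g00 * g11 - g01 * g01) =
      h00 * h01 * g11 - h00 * h11 * g01 - h01 ^ 2 * g01 + h01 * h11 * g00 := by
    linear_combination h01 * f00 + h11 * f01
  have s10 : (w10 * h00 + w11 * h01) * (g00 * g11 - g01 * g01) =
      h00 * h01 * g11 - h00 * h11 * g01 - h01 ^ 2 * g01 + h01 * h11 * g00 := by
    linear_combination h00 * f10 + h01 * f11
  have s11 : (w10 * h01 + w11 * h11) * (g00 * g11 - g01 * g01) =
      h01 ^ 2 * g11 - 2 * h01 * h11 * g01 + h11 ^ 2 * g00 := by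
    linear_combination h01 * f10 + h11 * f11
  clear e00 e01 e10 e11 f00 f01 f10 f11
  generalize w00 * h00 + w01 * h01 = t00 at *
  generalize w00 * h01 + w01 * h11 = t01 at *
  generalize w10 * h00 + w11 * h01 = t10 at *
  generalize w10 * h01 + w11 * h11 = t11 at *
  ext i j
  fin_cases i <;> fin_cases j <;> simp [Matrix.mul_apply, Fin.sum_univ_two] <;>
    refine mul_right_cancel₀ hg ?_
  · linear_combination (x * g11 + y * h11) * s00 - (x * g01 + y * h01) * s10 +
      (g00 * g11 - g01 * g01) * (-x * hx - y * hy) + (g11 * h00 - g01 * h01) * (y * hx - x * hy)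
  · linear_combination (x * g11 + y * h11) * s01 - (x * g01 + y * h01) * s11 +
      (g11 * h01 - g01 * h11) * (y * hx - x * hy)
  · linear_combination -(x * g01 + y * h01) * s00 + (x * g00 + y * h00) * s10 +
      (g00 * h01 - g01 * h00) * (y * hx - x * hy)
  · linear_combination -(x * g01 + y * h01) * s01 + (x * g00 + y * h00) * s11 +
      (g00 * g11 - g01 * g01) * (-x * hx - y * hy) + (g00 * h11 - g01 * h01) * (y * hx - x * hy)

/-- This is `Im (conj D · dD)` for `D = det(g + ih)`. The terms in `r` act as an infinitesimal
change of basis and alter `D` by the real factor `2 tr r`, so they drop out. What remains is the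
trace of `c` against the adjugate of `g + ih`. -/
theorem argDeriv_identity {g00 g01 g11 h00 h01 h11 r00 r01 r10 r11 c00 c01 c11 x y : ℝ}
    (hx : x = g00 * g11 - g01 ^ 2 - (h00 * h11 - h01 ^ 2))
    (hy : y = g00 * h11 + g11 * h00 - 2 * (g01 * h01))
    {p00 p01 p10 p11 q00 q01 q10 q11 : ℝ}
    (hp00 : p00 = r00 * g00 + r01 * g01) (hp01 : p01 = r00 * g01 + r01 * g11)
    (hp10 : p10 = r10 * g00 + r11 * g01) (hp11 : p11 = r10 * g01 + r11 * g11)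
    (hq00 : q00 = r00 * h00 + r01 * h01) (hq01 : q01 = r00 * h01 + r01 * h11)
    (hq10 : q10 = r10 * h00 + r11 * h01) (hq11 : q11 = r10 * h01 + r11 * h11)
    {dg00 dg01 dg11 dh00 dh01 dh11 : ℝ}
    (hg00 : dg00 = p00 + p00) (hg01 : dg01 = p01 + p10) (hg11 : dg11 = p11 + p11)
    (hh00 : dh00 = c00 + q00 + q00) (hh01 : dh01 = c01 + q01 + q10)
    (hh11 : dh11 = c11 + q11 + q11) :
    (dg00 * h11 + g00 * dh11 + (dg11 * h00 + g11 * dh00) - 2 * (dg01 * h01 + g01 * dh01)) * x -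
      (dg00 * g11 + g00 * dg11 - 2 * g01 * dg01 -
        (dh00 * h11 + h00 * dh11 - 2 * h01 * dh01)) * y =
    (x * g11 + y * h11) * c00 - 2 * (x * g01 + y * h01) * c01 + (x * g00 + y * h00) * c11 := by
  subst hg00 hg01 hg11 hh00 hh01 hh11 hp00 hp01 hp10 hp11 hq00 hq01 hq10 hq11 hx hy
  ring

namespace FirstJet

variable {F n : R42} {a b : Plane →L[ℝ] R42} {c : Plane →L[ℝ] R31 × R31}

theorem shape_coord (h : FirstJet F n a b) (X : Plane) (v : R42) : sca (b X) v =
    jetShape a b X 0 * sca (a (bas 0)) v + jetShape a b X 1 * sca (a (bas 1)) v := by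
  conv_lhs => rw [← h.shape X, plane_eq (jetShape a b X)]
  rw [map_add, map_smul, map_smul, sca_add_left, sca_smul_left, sca_smul_left]

/-- The inverse of the induced metric is the real part of `(g + i h)⁻¹`. -/
theorem inv_coeff (h : FirstJet F n a b) (hc : ∀ X, c X = bivPair (b X) F + bivPair n (a X))
    {x y : ℝ} (hx : x = angleRe (a (bas 0)) (a (bas 1)) (b (bas 0)) (b (bas 1)))
    (hy : y = angleIm (a (bas 0)) (a (bas 1)) (b (bas 0)) (b (bas 1))) :
    (coeff fun X Y => grMetric (c X) (c Y))⁻¹ =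
      (x ^ 2 + y ^ 2)⁻¹ • (x • !![sca (a (bas 1)) (a (bas 1)), -sca (a (bas 0)) (a (bas 1));
          -sca (a (bas 0)) (a (bas 1)), sca (a (bas 0)) (a (bas 0))] +
        y • !![sca (b (bas 1)) (a (bas 1)), -sca (b (bas 0)) (a (bas 1));
          -sca (b (bas 0)) (a (bas 1)), sca (b (bas 0)) (a (bas 0))]) := by
  have hxy : x ^ 2 + y ^ 2 ≠ 0 := by rw [hx, hy]; exact h.angle_sq_pos.ne'
  have hs := h.symm (bas 1) (bas 0)
  have hg := sca_comm (a (bas 1)) (a (bas 0))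
  rw [← inv_add_third_form h.adaptedFrame.pos.ne' hx hy hxy
    (by rw [h.shape_coord (bas 0) (a (bas 0)), hg])
    (h.shape_coord (bas 0) (a (bas 1)))
    (by rw [← hs, h.shape_coord (bas 1) (a (bas 0)), hg])
    (h.shape_coord (bas 1) (a (bas 1)))]
  congr 1
  have e : ∀ i j, (coeff fun X Y => grMetric (c X) (c Y)) i j =
      sca (a (bas i)) (a (bas j)) + (jetShape a b (bas i) 0 * sca (b (bas j)) (a (bas 0)) +
        jetShape a b (bas i) 1 * sca (b (bas j)) (a (bas 1))) := fun i j => by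
    rw [sca_comm (b (bas j)), sca_comm (b (bas j)), ← h.shape_coord]
    exact h.induced hc _ _
  ext i j
  rw [e]
  fin_cases i <;> fin_cases j <;> simp [hs, hg]

end FirstJet

namespace SecondJet

variable {F n : R42} {a b : Plane →L[ℝ] R42} {c : Plane →L[ℝ] R31 × R31}
  {F₂ n₂ : Fin 2 → Fin 2 → R42}

theorem cubicForm_swap (h : SecondJet F n a b F₂ n₂) (i j k : Fin 2) :
    cubicForm a b F₂ n₂ i j k = cubicForm a b F₂ n₂ i k j := by
  have := h.codazzi i j k
  simp only [cubicForm]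
  rw [sca_comm (F₂ i j), sca_comm (F₂ i k)]
  linarith

/-- Commuting partial derivatives exchange the first two indices, and Codazzi exchanges the last
two. -/
theorem cubicForm_symm (h : SecondJet F n a b F₂ n₂) (i j k : Fin 2) :
    cubicForm a b F₂ n₂ i j k = cubicForm a b F₂ n₂ k i j := by
  rw [h.cubicForm_swap i j k]
  simp only [cubicForm]
  rw [h.symmF i k, h.symmn i k]

theorem argDeriv_eq (h : SecondJet F n a b F₂ n₂)
    (hc : ∀ X, c X = bivPair (b X) F + bivPair n (a X)) (k : Fin 2) :
    argDeriv (angleRe (a (bas 0)) (a (bas 1)) (b (bas 0)) (b (bas 1)))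
      (angleIm (a (bas 0)) (a (bas 1)) (b (bas 0)) (b (bas 1)))
      (dAngleRe a b F₂ n₂ k) (dAngleIm a b F₂ n₂ k) =
    ∑ i, ∑ j, (coeff fun X Y => grMetric (c X) (c Y))⁻¹ i j * cubicForm a b F₂ n₂ k i j := by
  have hs := h.symm (bas 1) (bas 0)
  have hg := sca_comm (a (bas 1)) (a (bas 0))
  have hcs := h.cubicForm_swap k 1 0
  rw [h.inv_coeff hc rfl rfl, argDeriv, div_eq_inv_mul]
  -- The coordinates of `r` are the Christoffel symbols. The parts of `F₂` along `n` and `F` do not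
  -- contribute, since `a` and `b` take values orthogonal to both.
  choose r hr using fun i => h.decomp (F₂ k i)
  have hp : ∀ i j, sca (F₂ k i) (a (bas j)) =
      r i 0 * sca (a (bas 0)) (a (bas j)) + r i 1 * sca (a (bas 1)) (a (bas j)) := by
    intro i j
    conv_lhs => rw [hr i, plane_eq (r i)]
    simp only [map_add, map_smul, sca_add_left, sca_smul_left]
    rw [sca_comm n, sca_comm F (a _), h.an, h.aF]; ring
  have hq : ∀ i j, sca (F₂ k i) (b (bas j)) =
      r i 0 * sca (b (bas 0)) (a (bas j)) + r i 1 * sca (b (bas 1)) (a (bas j)) := by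
    intro i j
    conv_lhs => rw [hr i, plane_eq (r i)]
    simp only [map_add, map_smul, sca_add_left, sca_smul_left]
    rw [sca_comm n, sca_comm F (b _), h.bn, h.bF, sca_comm (a _), sca_comm (a _),
      h.symm (bas j), h.symm (bas j)]; ring
  have hdg : ∀ i j, sca (F₂ k i) (a (bas j)) + sca (a (bas i)) (F₂ k j) =
      sca (F₂ k i) (a (bas j)) + sca (F₂ k j) (a (bas i)) := fun i j => by
    rw [sca_comm (F₂ k j)]
  have hdh : ∀ i j, sca (n₂ k i) (a (bas j)) + sca (b (bas i)) (F₂ k j) =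
      cubicForm a b F₂ n₂ k i j + sca (F₂ k i) (b (bas j)) + sca (F₂ k j) (b (bas i)) :=
    fun i j => by rw [cubicForm, sca_comm (b (bas i))]; ring
  have key := argDeriv_identity (x := angleRe (a (bas 0)) (a (bas 1)) (b (bas 0)) (b (bas 1)))
    (y := angleIm (a (bas 0)) (a (bas 1)) (b (bas 0)) (b (bas 1))) rfl rfl
    (by rw [hp 0 0, hg]) (hp 0 1) (by rw [hp 1 0, hg]) (hp 1 1)
    (by rw [hq 0 0, hs]) (hq 0 1) (by rw [hq 1 0, hs]) (hq 1 1)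
    (hdg 0 0) (hdg 0 1) (hdg 1 1) (hdh 0 0) (hdh 0 1) (hdh 1 1)
  refine (congrArg _ key).trans ?_
  simp [Fin.sum_univ_two, hcs]
  ring

/-- Both sides have the form required by `eq_zero_of_orthogonal`, so it suffices to test their
difference against `c V` and `J (c V)`. Against `c V` both vanish. Against `J (c V)` the left side
gives the `σ`-trace of the cubic form, and the right side gives `ℓ V` because `J` is an isometry. -/
theorem meanCurvature_eq (h : SecondJet F n a b F₂ n₂)
    (hc : ∀ X, c X = bivPair (b X) F + bivPair n (a X)) (ℓ : Plane →L[ℝ] ℝ)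
    (hℓ : ∀ k, ℓ (bas k) = ∑ i, ∑ j,
      (coeff fun X Y => grMetric (c X) (c Y))⁻¹ i j * cubicForm a b F₂ n₂ k i j)
    {G₂ : Fin 2 → Fin 2 → R31 × R31}
    (hG : ∀ i j, G₂ i j = bivPair (n₂ i j) F + bivPair (b (bas j)) (a (bas i)) +
      (bivPair (b (bas i)) (a (bas j)) + bivPair n (F₂ i j))) :
    ∑ i, ∑ j, (coeff fun X Y => grMetric (c X) (c Y))⁻¹ i j •
        (grTangentProj (bivPair n F) (G₂ i j) - c (raise (fun X Y => grMetric (c X) (c Y))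
          fun X => grMetric (grTangentProj (bivPair n F) (G₂ i j)) (c X))) =
      grJ (bivPair n F) (c (raise (fun X Y => grMetric (c X) (c Y)) fun X => ℓ X)) := by
  set R := (coeff fun X Y => grMetric (c X) (c Y))⁻¹
  set P := bivPair n F
  set D : Fin 2 → Fin 2 → Plane := fun i j => raise (fun X Y => grMetric (c X) (c Y))
    fun X => grMetric (grTangentProj P (G₂ i j)) (c X)
  have hZ := h.induced_raise hc ℓ
  set Z := raise (fun X Y => grMetric (c X) (c Y)) fun X => ℓ X
  have hD : ∀ i j V, grMetric (c (D i j)) (c V) = grMetric (grTangentProj P (G₂ i j)) (c V) :=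
    fun i j V => h.induced_raise hc ((grMetricL (grTangentProj P (G₂ i j))).comp c) V
  have hsum : ∀ (w : Fin 2 → Fin 2 → R31 × R31) v,
      grMetric (∑ i, ∑ j, R i j • w i j) v = ∑ i, ∑ j, R i j * grMetric (w i j) v := by
    intro w v
    simp only [Fin.sum_univ_two, grMetric_add_left, grMetric_smul_left]
  have hproj : ∀ i j, ∃ X Y, grTangentProj P (G₂ i j) = bivPair (a X) F + bivPair n (a Y) := by
    intro i j
    obtain ⟨X, hX⟩ := h.decomp (n₂ i j)
    obtain ⟨Y, hY⟩ := h.decomp (F₂ i j)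
    refine ⟨X, Y, ?_⟩
    rw [hG, ← h.shape (bas i), ← h.shape (bas j), hX, hY]
    simp only [bivPair_add_left, bivPair_add_right, bivPair_smul_left, bivPair_smul_right,
      bivPair_self, grTangentProj_add, grTangentProj_smul, smul_zero, P,
      h.proj_tangent, h.proj_right, h.proj_left, h.proj_self, add_zero, zero_add]
  have hspan_c : ∀ X, c X = bivPair (a (jetShape a b X)) F + bivPair n (a X) := fun X => by
    rw [hc, h.shape]
  have hspan_J : ∀ X, grJ P (c X) =
      bivPair (a X) F + bivPair n (a ((-1 : ℝ) • jetShape a b X)) := fun X => by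
    rw [h.J_eq hc, map_smul, h.shape, bivPair_smul_right]
  choose X Y hXY using hproj
  rw [← sub_eq_zero]
  change (∑ i, ∑ j, R i j • (grTangentProj P (G₂ i j) - c (D i j))) - grJ P (c Z) = 0
  -- The two witnesses collect the coefficients given by `hXY`, `hspan_c` and `hspan_J`.
  refine h.eq_zero_of_orthogonal hc ⟨∑ i, ∑ j, R i j • (X i j - jetShape a b (D i j)) - Z,
    ∑ i, ∑ j, R i j • (Y i j - D i j) + jetShape a b Z, ?_⟩ ?_ ?_
  · have hl : ∀ v w u, bivPair (v - w) u = bivPair v u - bivPair w u := fun v w u =>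
      bivPairL.map_sub₂ v w u
    have hr : ∀ v w u, bivPair u (v - w) = bivPair u v - bivPair u w := fun v w u =>
      (bivPairL u).map_sub v w
    rw [hspan_J]
    simp only [hXY, hspan_c, Fin.sum_univ_two, map_add, map_sub, map_smul,
      bivPair_add_left, bivPair_add_right, bivPair_smul_left, bivPair_smul_right, hl, hr]
    module
  · intro V
    rw [grMetric_sub_left, hsum, h.lagrangian hc]
    simp [grMetric_sub_left, hD]
  · intro V
    change grMetric _ (grJ P (c V)) = 0
    rw [grMetric_sub_left, hsum, h.J_isometry hc, hZ]
    have hJ : ∀ i j V, grMetric (grTangentProj P (G₂ i j) - c (D i j)) (grJ P (c V)) =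
        grMetric (G₂ i j) (grJ P (c V)) := by
      intro i j V
      rw [grMetric_sub_left, grMetric_comm (c _), h.lagrangian hc, sub_zero,
        grMetric_grTangentProj]
      · rw [hspan_J, Prod.fst_add, mink_add_right, (h.mink_right _).1, (h.mink_left _).1, add_zero]
      · rw [hspan_J, Prod.snd_add, mink_add_right, (h.mink_right _).2, (h.mink_left _).2, add_zero]
    -- The second fundamental form of the Lagrangian surface, lowered with `J`, is the cubic form of
    -- the surface in `AdS₃`.
    have hcub : ∀ i j k, grMetric (G₂ i j) (grJ P (c (bas k))) =
        cubicForm a b F₂ n₂ k i j := by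
      intro i j k
      rw [← h.cubicForm_symm, cubicForm, h.J_eq hc, hG]
      simp only [grMetric_add_left, grMetric_add_right, grMetric_smul_right,
        grMetric_bivPair, h.FF,
        h.nn, h.nF, h.aF, h.bF, h.an, h.bn, sca_comm F, sca_comm n (a _), sca_comm n (b _)]
      ring
    simp only [hJ]
    rw [plane_eq V]
    simp only [map_add, map_smul, grJ_add, grJ_smul, grMetric_add_right, grMetric_smul_right,
      hcub, hℓ, Fin.sum_univ_two, smul_eq_mul]
    ring

end SecondJet

/-! ### The Lagrangian angle and the Gauss map -/

theorem arg_one_add_mul_I (r : ℝ) : Complex.arg ⟨1, r⟩ = Real.arctan r := by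
  rw [Complex.arg_of_re_nonneg (by simp), Real.arctan_eq_arcsin]
  congr 2
  rw [Complex.norm_def, Complex.normSq_mk]
  congr 1; ring

/-- The number is `D (1 + ir)(1 + is)`. Each factor `1 + ir` has argument in `(-π/2, π/2)`, so the
arguments add without a multiple of `2π`. -/
theorem arg_mul_one_add_mul_I {D : ℝ} (hD : 0 < D) (r s : ℝ) :
    Complex.arg ⟨D * (1 - r * s), D * (r + s)⟩ = Real.arctan r + Real.arctan s := by
  have e : (⟨D * (1 - r * s), D * (r + s)⟩ : ℂ) =
      (D : ℂ) * ((⟨1, r⟩ : ℂ) * (⟨1, s⟩ : ℂ)) := by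
    apply Complex.ext
    · simp
    · simp; ring_nf; simp
  have h1 : ∀ x : ℝ, (⟨1, x⟩ : ℂ) ≠ 0 := fun x h => by simpa using congrArg Complex.re h
  rw [e, Complex.arg_real_mul _ hD, Complex.arg_mul_eq_add_arg_iff (h1 r) (h1 s) |>.2,
    arg_one_add_mul_I, arg_one_add_mul_I]
  rw [arg_one_add_mul_I, arg_one_add_mul_I]
  have a1 := Real.arctan_mem_Ioo r
  have a2 := Real.arctan_mem_Ioo s
  constructor <;> linarith [a1.1, a1.2, a2.1, a2.2]

theorem mem_slitPlane_of_arctan {D : ℝ} (hD : 0 < D) (r s : ℝ) :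
    (⟨D * (1 - r * s), D * (r + s)⟩ : ℂ) ∈ Complex.slitPlane := by
  rw [Complex.mem_slitPlane_iff_arg]
  constructor
  · rw [arg_mul_one_add_mul_I hD]
    have a1 := Real.arctan_mem_Ioo r
    have a2 := Real.arctan_mem_Ioo s
    intro h
    linarith [a1.1, a1.2, a2.1, a2.2]
  · intro h
    have h1 := congrArg Complex.re h
    have h2 := congrArg Complex.im h
    simp [hD.ne'] at h1 h2
    have : s = -r := by linarith
    rw [this] at h1
    nlinarith [mul_self_nonneg r]

theorem roots_charpoly_fin_two (A : Matrix (Fin 2) (Fin 2) ℝ) {r s : ℝ} (ht : A.trace = r + s)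
    (hd : A.det = r * s) : A.charpoly.roots = {r, s} := by
  have e : A.charpoly = (Polynomial.X - Polynomial.C r) * (Polynomial.X - Polynomial.C s) := by
    rw [Matrix.charpoly_fin_two, ht, hd, map_add, map_mul]; ring
  rw [e, Polynomial.roots_mul (mul_ne_zero (Polynomial.X_sub_C_ne_zero _)
    (Polynomial.X_sub_C_ne_zero _)), Polynomial.roots_X_sub_C, Polynomial.roots_X_sub_C]
  rfl

/-- The complex number whose argument is the Lagrangian angle. -/
def angle (a₀ a₁ b₀ b₁ : R42) : ℂ := ⟨angleRe a₀ a₁ b₀ b₁, angleIm a₀ a₁ b₀ b₁⟩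

/-- `r` and `s` are the principal curvatures, the roots of `D x² - y x + K` with `D = det g`, `K =
det h` and `y` the imaginary part of `det(g + ih)`. They are real by `discrim_nonneg`. -/
theorem FirstJet.exists_principal {F n : R42} {a b : Plane →L[ℝ] R42} (h : FirstJet F n a b) :
    ∃ r s D : ℝ, 0 < D ∧
      D = (coeff fun X Y => sca (a X) (a Y)).det ∧
      D * (r * s) = (coeff fun X Y => sca (b X) (a Y)).det ∧
      D * (r + s) = angleIm (a (bas 0)) (a (bas 1)) (b (bas 0)) (b (bas 1)) ∧
      D * (1 - r * s) = angleRe (a (bas 0)) (a (bas 1)) (b (bas 0)) (b (bas 1)) := by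
  have hp := h.adaptedFrame.pos
  have hd := h.discrim_nonneg
  have hs := h.symm (bas 1) (bas 0)
  have hg := sca_comm (a (bas 1)) (a (bas 0))
  rw [det_coeff, det_coeff, hs, hg]
  rw [angleRe]
  set y := angleIm (a (bas 0)) (a (bas 1)) (b (bas 0)) (b (bas 1))
  set D := sca (a (bas 0)) (a (bas 0)) * sca (a (bas 1)) (a (bas 1)) -
    sca (a (bas 0)) (a (bas 1)) * sca (a (bas 0)) (a (bas 1)) with hD
  set K := sca (b (bas 0)) (a (bas 0)) * sca (b (bas 1)) (a (bas 1)) -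
    sca (b (bas 0)) (a (bas 1)) * sca (b (bas 0)) (a (bas 1)) with hK
  rw [sq (sca _ _), sq (sca _ _), ← hD, ← hK] at *
  have hsq := Real.mul_self_sqrt (sub_nonneg.2 hd)
  set q := Real.sqrt (y ^ 2 - 4 * (D * K))
  have hD0 : D ≠ 0 := hp.ne'
  have hrs : D * ((y + q) / (2 * D) * ((y - q) / (2 * D))) = K := by
    field_simp; linear_combination -hsq
  refine ⟨(y + q) / (2 * D), (y - q) / (2 * D), D, hp, rfl, hrs, ?_, ?_⟩
  · field_simp; ring
  · linear_combination -hrs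

theorem FirstJet.angle_mem_slitPlane {F n : R42} {a b : Plane →L[ℝ] R42}
    (h : FirstJet F n a b) :
    angle (a (bas 0)) (a (bas 1)) (b (bas 0)) (b (bas 1)) ∈ Complex.slitPlane := by
  obtain ⟨r, s, D, hD, -, -, e1, e2⟩ := h.exists_principal
  rw [angle, ← e1, ← e2]
  exact mem_slitPlane_of_arctan hD r s

/-- The effect of a linear change of coordinates on `angle`. -/
theorem FirstJet.angle_comp {F n : R42} {a b : Plane →L[ℝ] R42} (h : FirstJet F n a b)
    (X Y : Plane) : angle (a X) (a Y) (b X) (b Y) =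
      ((X 0 * Y 1 - X 1 * Y 0) ^ 2 : ℝ) *
        angle (a (bas 0)) (a (bas 1)) (b (bas 0)) (b (bas 1)) := by
  have hs := h.symm (bas 1) (bas 0)
  have hg := sca_comm (a (bas 1)) (a (bas 0))
  conv_lhs => rw [plane_eq X, plane_eq Y]
  apply Complex.ext <;>
    simp only [angle, angleRe, angleIm, map_add, map_smul, sca_add_left, sca_add_right,
      sca_smul_left, sca_smul_right, hs, hg, Complex.re_ofReal_mul, Complex.im_ofReal_mul] <;> ring

section Surface

variable {M : Type*} [TopologicalSpace M] [ChartedSpace (EuclideanSpace ℝ (Fin 2)) M]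

/-- The right side is the argument of a polynomial in first derivatives. It stays differentiable at
umbilics, where the eigenvalues taken separately need not be. -/
theorem lagrangianAngle_eq {F ν : M → R42} {p : M}
    (h : FirstJet (F p) (ν p) (diff F p) (diff ν p)) : lagrangianAngle F ν p =
      (angle (diff F p (bas 0)) (diff F p (bas 1)) (diff ν p (bas 0)) (diff ν p (bas 1))).arg := by
  obtain ⟨r, s, D, hD, hg, hh, e1, e2⟩ := h.exists_principal
  rw [angle, ← e1, ← e2, arg_mul_one_add_mul_I hD]
  have hD0 : D ≠ 0 := hD.ne'
  have hdet : (weingartenMatrix F ν p).det = r * s := by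
    rw [weingartenMatrix, Matrix.det_mul, Matrix.det_nonsing_inv, Ring.inverse_eq_inv']
    change (coeff fun X Y => sca (diff F p X) (diff F p Y)).det⁻¹ *
      (coeff fun X Y => sca (diff ν p X) (diff F p Y)).det = _
    rw [← hg, ← hh]; field_simp
  have htr : (weingartenMatrix F ν p).trace = r + s := by
    have hs := h.symm (bas 1) (bas 0)
    have hg' := sca_comm (diff F p (bas 1)) (diff F p (bas 0))
    rw [weingartenMatrix, Matrix.inv_def, Ring.inverse_eq_inv']
    change Matrix.trace (((coeff fun X Y => sca (diff F p X) (diff F p Y)).det⁻¹ •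
      (coeff (firstForm F p)).adjugate) * coeff (secondForm F ν p)) = _
    rw [← hg, Matrix.smul_mul, Matrix.trace_smul, smul_eq_mul, inv_mul_eq_iff_eq_mul₀ hD0, e1,
      Matrix.adjugate_fin_two, Matrix.trace_fin_two]
    simp [Matrix.mul_apply, Fin.sum_univ_two, coeff, firstForm, secondForm, angleIm, hs, hg']
    ring
  rw [lagrangianAngle, principalCurvatures, roots_charpoly_fin_two _ htr hdet]
  simp

/-- Duality contributes the factor `det4`, whose square is `det g`. The orientation sign and the
area density of the Hodge star turn it into `1`, in the second factor up to the minus sign built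
into `bivPair`. -/
theorem gaussMap_eq {F ν : M → R42} {p : M}
    (h : AdaptedFrame (diff F p (bas 0)) (diff F p (bas 1)) (ν p) (F p)) :
    gaussMap F ν p = bivPair (ν p) (F p) := by
  have hD := h.det4_ne_zero
  have hd : (coeff (firstForm F p)).det =
      det4 (diff F p (bas 0)) (diff F p (bas 1)) (ν p) (F p) ^ 2 := by
    rw [h.det4_sq, det_coeff, firstForm, firstForm, firstForm, firstForm,
      sca_comm (diff F p (bas 1)) (diff F p (bas 0))]
  have key : orientSign F ν p * det4 (diff F p (bas 0)) (diff F p (bas 1)) (ν p) (F p) /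
      Real.sqrt (coeff (firstForm F p)).det = 1 := by
    rw [hd, Real.sqrt_sq_eq_abs, orientSign]
    change Real.sign (det4 _ _ _ _) * _ / _ = _
    rcases hD.lt_or_gt with h0 | h0
    · rw [Real.sign_of_neg h0, abs_of_neg h0, neg_one_mul, div_self (neg_ne_zero.2 hD)]
    · rw [Real.sign_of_pos h0, abs_of_pos h0, one_mul, div_self hD]
  refine Prod.ext ?_ ?_
  · ext A
    have e := congrFun h.bivPlus_eq A
    simp only [bivPlus, Pi.smul_apply, smul_eq_mul] at e
    simp only [gaussMap, hodge, bivPair, bivPlus, Pi.smul_apply, smul_eq_mul]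
    rw [e, ← mul_assoc, mul_div_right_comm, key, one_mul]
  · ext A
    have e := congrFun h.bivMinus_eq A
    simp only [bivMinus, Pi.smul_apply, smul_eq_mul] at e
    simp only [gaussMap, hodge, bivPair, bivMinus, Pi.smul_apply, smul_eq_mul]
    rw [e, neg_mul, mul_neg, ← mul_assoc, neg_div, mul_div_right_comm, key, one_mul, mul_neg,
      neg_mul]

end Surface

/-! ### Calculus on sets with unique derivatives -/

section Calculus

variable {E : Type*} [NormedAddCommGroup E] [NormedSpace ℝ E]
  {V : Type*} [NormedAddCommGroup V] [NormedSpace ℝ V]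
  {V₁ : Type*} [NormedAddCommGroup V₁] [NormedSpace ℝ V₁]
  {V₂ : Type*} [NormedAddCommGroup V₂] [NormedSpace ℝ V₂]

/-- The derivative, within `S`, of `w` in the direction `v`. -/
def pd (S : Set E) (v : E) (w : E → V) (q : E) : V := fderivWithin ℝ w S q v

variable {S : Set E} {w : E → V} {q : E}

theorem pd_contDiffOn (hS : UniqueDiffOn ℝ S) (hw : ContDiffOn ℝ ∞ w S) (v : E) :
    ContDiffOn ℝ ∞ (pd S v w) S :=
  (hw.fderivWithin hS (m := ∞) (by simp)).clm_apply contDiffOn_const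

theorem diffWithin (hw : ContDiffOn ℝ ∞ w S) (hq : q ∈ S) : DifferentiableWithinAt ℝ w S q :=
  (hw q hq).differentiableWithinAt (by simp)

/-- The condition `hS'` carries the symmetry of second derivatives to boundary points, in particular
to the initial time. -/
theorem pd_symm (hS : UniqueDiffOn ℝ S) (hS' : S ⊆ closure (interior S))
    (hw : ContDiffOn ℝ ∞ w S) (hq : q ∈ S) (u v : E) :
    pd S u (pd S v w) q = pd S v (pd S u w) q := by
  have hd : DifferentiableWithinAt ℝ (fderivWithin ℝ w S) S q :=
    diffWithin (hw.fderivWithin hS (m := ∞) (by simp)) hq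
  have e : ∀ u v : E, pd S u (pd S v w) q = fderivWithin ℝ (fderivWithin ℝ w S) S q u v := by
    intro u v
    have : HasFDerivWithinAt (pd S v w) _ S q :=
      hd.hasFDerivWithinAt.clm_apply (hasFDerivWithinAt_const v q S)
    rw [pd, this.fderivWithin (hS q hq)]
    simp
  rw [e, e]
  exact (hw q hq).isSymmSndFDerivWithinAt (by simpa using WithTop.coe_le_coe.2 (le_top : (2 : ℕ∞) ≤ ⊤)) hS (hS' hq) hq u v

theorem pd_bilin (B : V₁ →L[ℝ] V₂ →L[ℝ] V) (hS : UniqueDiffOn ℝ S) {w₁ : E → V₁} {w₂ : E → V₂}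
    (h₁ : ContDiffOn ℝ ∞ w₁ S) (h₂ : ContDiffOn ℝ ∞ w₂ S) (hq : q ∈ S) (v : E) :
    pd S v (fun x => B (w₁ x) (w₂ x)) q = B (pd S v w₁ q) (w₂ q) + B (w₁ q) (pd S v w₂ q) := by
  simp only [pd]
  rw [(B.hasFDerivWithinAt_of_bilinear (diffWithin h₁ hq).hasFDerivWithinAt
    (diffWithin h₂ hq).hasFDerivWithinAt).fderivWithin (hS q hq)]
  simp [add_comm]

theorem contDiffOn_bilin (B : V₁ →L[ℝ] V₂ →L[ℝ] V) {w₁ : E → V₁} {w₂ : E → V₂}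
    (h₁ : ContDiffOn ℝ ∞ w₁ S) (h₂ : ContDiffOn ℝ ∞ w₂ S) :
    ContDiffOn ℝ ∞ (fun x => B (w₁ x) (w₂ x)) S :=
  B.isBoundedBilinearMap.contDiff.comp_contDiffOn (h₁.prodMk h₂)

theorem pd_congr {w' : E → V} (h : EqOn w w' S) (hq : q ∈ S) (v : E) :
    pd S v w q = pd S v w' q := by
  simp only [pd]
  rw [fderivWithin_congr h (h hq)]

theorem pd_const (c : V) (v : E) : pd S v (fun _ => c) q = 0 := by
  simp [pd]

theorem pd_add (hS : UniqueDiffOn ℝ S) {w' : E → V} (h : ContDiffOn ℝ ∞ w S)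
    (h' : ContDiffOn ℝ ∞ w' S) (hq : q ∈ S) (v : E) :
    pd S v (fun x => w x + w' x) q = pd S v w q + pd S v w' q := by
  simp only [pd]
  rw [fderivWithin_fun_add (hS q hq) (diffWithin h hq) (diffWithin h' hq)]
  rfl

theorem pd_sub (hS : UniqueDiffOn ℝ S) {w' : E → V} (h : ContDiffOn ℝ ∞ w S)
    (h' : ContDiffOn ℝ ∞ w' S) (hq : q ∈ S) (v : E) :
    pd S v (fun x => w x - w' x) q = pd S v w q - pd S v w' q := by
  simp only [pd]
  rw [fderivWithin_fun_sub (hS q hq) (diffWithin h hq) (diffWithin h' hq)]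
  rfl

theorem pd_mul (hS : UniqueDiffOn ℝ S) {f g : E → ℝ} (h : ContDiffOn ℝ ∞ f S)
    (h' : ContDiffOn ℝ ∞ g S) (hq : q ∈ S) (v : E) :
    pd S v (fun x => f x * g x) q = pd S v f q * g q + f q * pd S v g q :=
  pd_bilin (ContinuousLinearMap.mul ℝ ℝ) hS h h' hq v

theorem pd_sca (hS : UniqueDiffOn ℝ S) {w₁ w₂ : E → R42} (h₁ : ContDiffOn ℝ ∞ w₁ S)
    (h₂ : ContDiffOn ℝ ∞ w₂ S) (hq : q ∈ S) (v : E) :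
    pd S v (fun x => sca (w₁ x) (w₂ x)) q = sca (pd S v w₁ q) (w₂ q) + sca (w₁ q) (pd S v w₂ q) :=
  pd_bilin scaL hS h₁ h₂ hq v

theorem contDiffOn_sca {w₁ w₂ : E → R42} (h₁ : ContDiffOn ℝ ∞ w₁ S)
    (h₂ : ContDiffOn ℝ ∞ w₂ S) : ContDiffOn ℝ ∞ (fun x => sca (w₁ x) (w₂ x)) S :=
  contDiffOn_bilin scaL h₁ h₂

theorem contDiffOn_angleRe {w₀ w₁ z₀ z₁ : E → R42} (h₀ : ContDiffOn ℝ ∞ w₀ S)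
    (h₁ : ContDiffOn ℝ ∞ w₁ S) (k₀ : ContDiffOn ℝ ∞ z₀ S) (k₁ : ContDiffOn ℝ ∞ z₁ S) :
    ContDiffOn ℝ ∞ (fun x => angleRe (w₀ x) (w₁ x) (z₀ x) (z₁ x)) S :=
  (((contDiffOn_sca h₀ h₀).mul (contDiffOn_sca h₁ h₁)).sub ((contDiffOn_sca h₀ h₁).pow 2)).sub
    (((contDiffOn_sca k₀ h₀).mul (contDiffOn_sca k₁ h₁)).sub ((contDiffOn_sca k₀ h₁).pow 2))

theorem contDiffOn_angleIm {w₀ w₁ z₀ z₁ : E → R42} (h₀ : ContDiffOn ℝ ∞ w₀ S)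
    (h₁ : ContDiffOn ℝ ∞ w₁ S) (k₀ : ContDiffOn ℝ ∞ z₀ S) (k₁ : ContDiffOn ℝ ∞ z₁ S) :
    ContDiffOn ℝ ∞ (fun x => angleIm (w₀ x) (w₁ x) (z₀ x) (z₁ x)) S :=
  (((contDiffOn_sca h₀ h₀).mul (contDiffOn_sca k₁ h₁)).add
    ((contDiffOn_sca h₁ h₁).mul (contDiffOn_sca k₀ h₀))).sub
    (contDiffOn_const.mul ((contDiffOn_sca h₀ h₁).mul (contDiffOn_sca k₀ h₁)))

theorem mk_eq_clm (x y : ℝ) : (⟨x, y⟩ : ℂ) = Complex.equivRealProdCLM.symm (x, y) := by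
  apply Complex.ext <;> simp

theorem contDiffOn_arg {x y : E → ℝ} (hx : ContDiffOn ℝ ∞ x S) (hy : ContDiffOn ℝ ∞ y S)
    (h : ∀ q ∈ S, (⟨x q, y q⟩ : ℂ) ∈ Complex.slitPlane) :
    ContDiffOn ℝ ∞ (fun q => (⟨x q, y q⟩ : ℂ).arg) S := by
  intro q hq
  have h1 : ContDiffWithinAt ℝ ∞ (fun q => (⟨x q, y q⟩ : ℂ)) S q := by
    simp only [mk_eq_clm]
    exact Complex.equivRealProdCLM.symm.contDiff.contDiffAt.comp_contDiffWithinAt q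
      ((hx q hq).prodMk (hy q hq))
  have h2 := ((Complex.contDiffAt_log (h q hq) (n := ∞)).restrict_scalars ℝ).comp_contDiffWithinAt
    q h1
  have h3 := Complex.imCLM.contDiff.contDiffAt.comp_contDiffWithinAt q h2 (n := ∞)
  exact h3.congr (fun _ _ => (Complex.log_im _).symm) (Complex.log_im _).symm

theorem pd_arg (hS : UniqueDiffOn ℝ S) {x y : E → ℝ} (hx : ContDiffOn ℝ ∞ x S)
    (hy : ContDiffOn ℝ ∞ y S) (hq : q ∈ S) (h : (⟨x q, y q⟩ : ℂ) ∈ Complex.slitPlane) (v : E) :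
    pd S v (fun q => (⟨x q, y q⟩ : ℂ).arg) q = argDeriv (x q) (y q) (pd S v x q) (pd S v y q) := by
  have h1 : HasFDerivWithinAt (fun q => (⟨x q, y q⟩ : ℂ))
      (Complex.equivRealProdCLM.symm.toContinuousLinearMap.comp
        ((fderivWithin ℝ x S q).prod (fderivWithin ℝ y S q))) S q := by
    simp only [mk_eq_clm]
    exact (ContinuousLinearEquiv.hasFDerivAt _).comp_hasFDerivWithinAt q
      ((diffWithin hx hq).hasFDerivWithinAt.prodMk (diffWithin hy hq).hasFDerivWithinAt)
  have h2 := (Complex.hasStrictFDerivAt_log_real h).hasFDerivAt.comp_hasFDerivWithinAt q h1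
  have h3 := (Complex.imCLM.hasFDerivAt).comp_hasFDerivWithinAt q h2
  have h4 : HasFDerivWithinAt (fun q => (⟨x q, y q⟩ : ℂ).arg) _ S q :=
    h3.congr (fun _ _ => (Complex.log_im _).symm) (Complex.log_im _).symm
  rw [pd, h4.fderivWithin (hS q hq)]
  simp [argDeriv, pd, Complex.inv_re, Complex.inv_im, Complex.normSq_mk]
  ring

end Calculus

/-! ### Charts -/

section Chart

variable {M : Type*} [TopologicalSpace M] [ChartedSpace (EuclideanSpace ℝ (Fin 2)) M]

/-- The domain of the coordinates `(x, t)` at `p`. -/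
def chartDom (p : M) (T : ℝ) : Set (Plane × ℝ) := (extChartAt (𝓡 2) p).target ×ˢ Ico 0 T

/-- A time dependent map in the coordinates at `p`. -/
def inChart {V : Type*} (p : M) (w : M → ℝ → V) (z : Plane × ℝ) : V :=
  w ((extChartAt (𝓡 2) p).symm z.1) z.2

theorem inChart_self {V : Type*} (p : M) (w : M → ℝ → V) (t : ℝ) :
    inChart p w (extChartAt (𝓡 2) p p, t) = w p t := by
  simp [inChart]

variable {V : Type*} [NormedAddCommGroup V] [NormedSpace ℝ V]
  {T : ℝ} {w : M → ℝ → V} {p : M} {t : ℝ}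

theorem uniqueDiffOn_chartDom (p : M) (T : ℝ) : UniqueDiffOn ℝ (chartDom p T) :=
  (isOpen_extChartAt_target p).uniqueDiffOn.prod (uniqueDiffOn_Ico 0 T)

theorem chartDom_subset (p : M) (hT : 0 < T) :
    chartDom p T ⊆ closure (interior (chartDom p T)) := by
  rw [chartDom, interior_prod_eq, closure_prod_eq, interior_Ico, closure_Ioo hT.ne,
    (isOpen_extChartAt_target p).interior_eq]
  exact prod_mono subset_closure Ico_subset_Icc_self

theorem mem_chartDom (p : M) (ht : t ∈ Ico 0 T) : (extChartAt (𝓡 2) p p, t) ∈ chartDom p T :=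
  ⟨mem_extChartAt_target p, ht⟩

theorem SmoothFamily.contDiffOn [IsManifold (𝓡 2) ∞ M] (hw : SmoothFamily T w) (p : M) :
    ContDiffOn ℝ ∞ (inChart p w) (chartDom p T) := by
  rw [← contMDiffOn_iff_contDiffOn]
  have h1 : ContMDiffOn 𝓘(ℝ, Plane × ℝ) ((𝓡 2).prod 𝓘(ℝ, ℝ)) ∞
      (fun z : Plane × ℝ => ((extChartAt (𝓡 2) p).symm z.1, z.2)) (chartDom p T) := by
    have h2 : ContMDiffOn 𝓘(ℝ, Plane × ℝ) 𝓘(ℝ, Plane) ∞ (fun z : Plane × ℝ => z.1)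
        (chartDom p T) := contDiff_fst.contMDiff.contMDiffOn
    have h3 : ContMDiffOn 𝓘(ℝ, Plane × ℝ) 𝓘(ℝ, ℝ) ∞ (fun z : Plane × ℝ => z.2)
        (chartDom p T) := contDiff_snd.contMDiff.contMDiffOn
    exact ((contMDiffOn_extChartAt_symm p).comp h2 fun z hz => hz.1).prodMk h3
  exact ContMDiffOn.comp (g := fun q : M × ℝ => w q.1 q.2) hw h1 fun z hz => ⟨mem_univ _, hz.2⟩

theorem SmoothFamily.of_contDiffOn [IsManifold (𝓡 2) ∞ M]
    (hw : ∀ p : M, ContDiffOn ℝ ∞ (inChart p w) (chartDom p T)) : SmoothFamily T w := by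
  rintro ⟨p, t⟩ ⟨-, ht⟩
  have h1 : ContMDiffOn ((𝓡 2).prod 𝓘(ℝ, ℝ)) 𝓘(ℝ, Plane × ℝ) ∞
      (fun q : M × ℝ => (extChartAt (𝓡 2) p q.1, q.2)) ((chartAt _ p).source ×ˢ Ico 0 T) :=
    (contMDiffOn_extChartAt.comp contMDiffOn_fst fun q hq => hq.1).prodMk_space contMDiffOn_snd
  have h2 := (contMDiffOn_iff_contDiffOn.2 (hw p)).comp h1 fun q hq =>
    ⟨(extChartAt (𝓡 2) p).map_source (by rw [extChartAt_source]; exact hq.1), hq.2⟩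
  have h3 := h2 (p, t) ⟨mem_chart_source _ p, ht⟩
  have h4 : (chartAt (EuclideanSpace ℝ (Fin 2)) p).source ×ˢ Ico 0 T ∈
      nhdsWithin (p, t) (univ ×ˢ Ico 0 T) := by
    rw [nhdsWithin_prod_eq]
    exact Filter.prod_mem_prod (mem_nhdsWithin_of_mem_nhds (chart_source_mem_nhds _ p))
      self_mem_nhdsWithin
  refine (h3.congr ?_ ?_).mono_of_mem_nhdsWithin h4
  · intro q hq
    simp only [inChart, Function.comp]
    rw [(extChartAt (𝓡 2) p).left_inv (by rw [extChartAt_source]; exact hq.1)]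
  · simp [inChart]

theorem inChart_hasFDerivAt (hw : ContDiffOn ℝ ∞ (inChart p w) (chartDom p T))
    {z : Plane × ℝ} (hz : z ∈ chartDom p T) :
    HasFDerivAt (fun y => inChart p w (y, z.2))
      ((fderivWithin ℝ (inChart p w) (chartDom p T) z).comp
        (ContinuousLinearMap.inl ℝ Plane ℝ)) z.1 := by
  have h1 := (diffWithin hw hz).hasFDerivWithinAt
  have h2 : HasFDerivWithinAt (fun y : Plane => (y, z.2)) (ContinuousLinearMap.inl ℝ Plane ℝ)
      (extChartAt (𝓡 2) p).target z.1 :=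
    (hasFDerivAt_prodMk_left z.1 z.2).hasFDerivWithinAt
  exact (HasFDerivWithinAt.comp (g := inChart p w) (f := fun y : Plane => (y, z.2)) z.1 h1 h2
    fun y hy => (⟨hy, hz.2⟩ : (y, z.2) ∈ chartDom p T)).hasFDerivAt ((isOpen_extChartAt_target p).mem_nhds hz.1)

theorem fderiv_inChart (hw : ContDiffOn ℝ ∞ (inChart p w) (chartDom p T))
    {z : Plane × ℝ} (hz : z ∈ chartDom p T) (X : Plane) :
    fderiv ℝ (fun y => inChart p w (y, z.2)) z.1 X =
      pd (chartDom p T) (X, 0) (inChart p w) z := by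
  rw [(inChart_hasFDerivAt hw hz).fderiv]; rfl

theorem SmoothFamily.slice (hw : SmoothFamily T w) (ht : t ∈ Ico 0 T) :
    ContMDiff (𝓡 2) 𝓘(ℝ, V) ∞ (fun q => w q t) := by
  have h1 : ContMDiff (𝓡 2) ((𝓡 2).prod 𝓘(ℝ, ℝ)) ∞ (fun q : M => (q, t)) :=
    contMDiff_id.prodMk contMDiff_const
  exact ContMDiffOn.comp_contMDiff (g := fun q : M × ℝ => w q.1 q.2) hw h1
    fun q => ⟨mem_univ _, ht⟩

theorem diff_eq_fderiv {u : M → V} (hu : MDifferentiableAt (𝓡 2) 𝓘(ℝ, V) u p) :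
    diff u p = fderiv ℝ (u ∘ (extChartAt (𝓡 2) p).symm) (extChartAt (𝓡 2) p p) := by
  rw [diff, hu.mfderiv, ModelWithCorners.range_eq_univ, fderivWithin_univ]
  rfl

/-- The differential at `p` is read in the preferred chart at `p`, so at the centre of that chart no
transition map enters. At other points `exists_basis_change` is needed. -/
theorem SmoothFamily.diff_eq [IsManifold (𝓡 2) ∞ M] (hw : SmoothFamily T w) (p : M)
    (ht : t ∈ Ico 0 T) (X : Plane) :
    diff (fun q => w q t) p X =
      pd (chartDom p T) (X, 0) (inChart p w) (extChartAt (𝓡 2) p p, t) := by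
  rw [← fderiv_inChart (hw.contDiffOn p) (mem_chartDom p ht),
    diff_eq_fderiv (((hw.slice ht) p).mdifferentiableAt (by simp))]
  rfl

theorem SmoothFamily.diff2_eq [IsManifold (𝓡 2) ∞ M] (hw : SmoothFamily T w) (p : M)
    (ht : t ∈ Ico 0 T) (i j : Fin 2) :
    diff2 (fun q => w q t) p i j =
      pd (chartDom p T) (bas i, 0) (pd (chartDom p T) (bas j, 0) (inChart p w))
        (extChartAt (𝓡 2) p p, t) := by
  have hc := hw.contDiffOn p
  have hU := uniqueDiffOn_chartDom p T
  have h1 := diffWithin (pd_contDiffOn hU hc (bas j, 0)) (mem_chartDom p ht)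
  have h2 : HasFDerivAt (fun y => pd (chartDom p T) (bas j, 0) (inChart p w) (y, t))
      ((fderivWithin ℝ (pd (chartDom p T) (bas j, 0) (inChart p w)) (chartDom p T)
        (extChartAt (𝓡 2) p p, t)).comp (ContinuousLinearMap.inl ℝ Plane ℝ))
      (extChartAt (𝓡 2) p p) :=
    (HasFDerivWithinAt.comp (f := fun y : Plane => (y, t)) _ h1.hasFDerivWithinAt
      ((hasFDerivAt_prodMk_left (extChartAt (𝓡 2) p p) t).hasFDerivWithinAt
        (s := (extChartAt (𝓡 2) p).target)) fun y hy => (⟨hy, ht⟩ : (y, t) ∈ chartDom p T)).hasFDerivAt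
      (extChartAt_target_mem_nhds p)
  have h3 : (fun y => fderiv ℝ ((fun q => w q t) ∘ (extChartAt (𝓡 2) p).symm) y (bas j))
      =ᶠ[nhds (extChartAt (𝓡 2) p p)]
      fun y => pd (chartDom p T) (bas j, 0) (inChart p w) (y, t) := by
    filter_upwards [extChartAt_target_mem_nhds p] with y hy
    exact fderiv_inChart hc (z := (y, t)) ⟨hy, ht⟩ (bas j)
  rw [diff2, h3.fderiv_eq, h2.fderiv]
  rfl

theorem SmoothFamily.hasVelocity [IsManifold (𝓡 2) ∞ M] (hw : SmoothFamily T w) (p : M)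
    {z : Plane × ℝ} (hz : z ∈ chartDom p T) :
    HasVelocity T (w ((extChartAt (𝓡 2) p).symm z.1)) z.2
      (pd (chartDom p T) (0, 1) (inChart p w) z) := by
  have h1 := (diffWithin (hw.contDiffOn p) hz).hasFDerivWithinAt
  have h2 : HasDerivWithinAt (fun s : ℝ => (z.1, s)) ((0 : Plane), (1 : ℝ))
      (Ico 0 T) z.2 := (hasDerivWithinAt_const _ _ _).prodMk (hasDerivWithinAt_id _ _)
  exact h1.comp_hasDerivWithinAt z.2 h2 fun s hs => (⟨hz.1, hs⟩ : (z.1, s) ∈ chartDom p T)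

theorem HasVelocity.unique {c : ℝ → V} {v v' : V} (ht : t ∈ Ico 0 T)
    (h : HasVelocity T c t v) (h' : HasVelocity T c t v') : v = v' :=
  (uniqueDiffOn_Ico 0 T t ht).eq_deriv _ h h'

/-- The coordinate derivatives at `p` are the differentials at a nearby point, up to a change of
basis that does not depend on the map. -/
theorem exists_basis_change [IsManifold (𝓡 2) ∞ M] (p : M) {z : Plane × ℝ}
    (hz : z ∈ chartDom p T) : ∃ A : Plane →L[ℝ] Plane, Function.Bijective A ∧
      ∀ {V : Type} [NormedAddCommGroup V] [NormedSpace ℝ V] (w : M → ℝ → V), SmoothFamily T w →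
        ∀ X, pd (chartDom p T) (X, 0) (inChart p w) z =
          diff (fun q => w q z.2) ((extChartAt (𝓡 2) p).symm z.1) (A X) := by
  have hinv := isInvertible_mfderivWithin_extChartAt_symm (I := 𝓡 2) hz.1
  rw [ModelWithCorners.range_eq_univ, mfderivWithin_univ] at hinv
  refine ⟨mfderiv 𝓘(ℝ, Plane) (𝓡 2) (extChartAt (𝓡 2) p).symm z.1, ?_, ?_⟩
  · obtain ⟨e, he⟩ := hinv
    rw [← he]
    exact e.bijective
  · intro V _ _ w hw X
    have h1 : MDifferentiableAt 𝓘(ℝ, Plane) (𝓡 2) (extChartAt (𝓡 2) p).symm z.1 := by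
      have := mdifferentiableWithinAt_extChartAt_symm (I := 𝓡 2) hz.1
      rwa [ModelWithCorners.range_eq_univ, mdifferentiableWithinAt_univ] at this
    have h2 : MDifferentiableAt (𝓡 2) 𝓘(ℝ, V) (fun q => w q z.2)
        ((extChartAt (𝓡 2) p).symm z.1) := (hw.slice hz.2 _).mdifferentiableAt (by simp)
    have h3 := mfderiv_comp z.1 h2 h1
    rw [← fderiv_inChart (hw.contDiffOn p) hz, ← mfderiv_eq_fderiv]
    exact DFunLike.congr_fun h3 X

end Chart

/-! ### The unit normal -/

/-- The vector product of three vectors of `ℝ⁴₂`, with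
`sca (cross4 a b d) c = det4 a b c d`. -/
def cross4 (a b d : R42) : R42 :=
  ![(a 1 * b 2 - a 2 * b 1) * d 3 - (a 1 * b 3 - a 3 * b 1) * d 2
      + (a 2 * b 3 - a 3 * b 2) * d 1,
    -((a 0 * b 2 - a 2 * b 0) * d 3) + (a 0 * b 3 - a 3 * b 0) * d 2
      - (a 2 * b 3 - a 3 * b 2) * d 0,
    -((a 0 * b 1 - a 1 * b 0) * d 3) + (a 0 * b 3 - a 3 * b 0) * d 1
      - (a 1 * b 3 - a 3 * b 1) * d 0,
    (a 0 * b 1 - a 1 * b 0) * d 2 - (a 0 * b 2 - a 2 * b 0) * d 1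
      + (a 1 * b 2 - a 2 * b 1) * d 0]

theorem sca_cross4 (a b d c : R42) : sca (cross4 a b d) c = det4 a b c d := by
  rw [det4_eq]; simp [sca, cross4]; ring

theorem AdaptedFrame.cross4_eq {a b c d : R42} (h : AdaptedFrame a b c d) :
    cross4 a b d = (-det4 a b c d) • c := by
  have e : ∀ u, sca (cross4 a b d + det4 a b c d • c) u =
      det4 a b u d + det4 a b c d * sca c u := fun u => by
    rw [sca_add_left, sca_smul_left, sca_cross4]
  have := h.eq_zero (v := cross4 a b d + det4 a b c d • c)
    (by rw [e, sca_comm c, h.ac, det4_eq]; ring) (by rw [e, sca_comm c, h.bc, det4_eq]; ring)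
    (by rw [e, h.cc]; ring) (by rw [e, h.cd, det4_eq a b d d]; ring)
  rw [neg_smul]
  exact eq_neg_of_add_eq_zero_left this

/-- A formula for the future directed unit normal. -/
theorem AdaptedFrame.normal_eq {a b c d : R42} (h : AdaptedFrame a b c d)
    (hf : sca c (timeField d) < 0) :
    0 < sca (cross4 a b d) (timeField d) ^ 2 ∧ 0 < -sca (cross4 a b d) (cross4 a b d) ∧
    c = (-(sca (cross4 a b d) (timeField d) / (Real.sqrt (sca (cross4 a b d) (timeField d) ^ 2) *
      Real.sqrt (-sca (cross4 a b d) (cross4 a b d))))) • cross4 a b d := by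
  have hD := h.det4_ne_zero
  -- The vector product is `-det4 • c`. Dividing by its length leaves `c` up to sign, and the sign
  -- of its product with the time field selects the future one.
  rw [h.cross4_eq]
  simp only [sca_smul_left, sca_smul_right, h.cc]
  set D := det4 a b c d
  set τ := sca c (timeField d)
  have e : -(-D * (-D * -1)) = D ^ 2 := by ring
  rw [e, Real.sqrt_sq_eq_abs, Real.sqrt_sq_eq_abs, smul_smul, abs_mul, abs_neg, abs_of_neg hf]
  refine ⟨by have := mul_ne_zero (neg_ne_zero.2 hD) hf.ne; positivity, by positivity, ?_⟩
  have hτ : τ ≠ 0 := hf.ne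
  have hA : |D| ≠ 0 := abs_ne_zero.2 hD
  have : -(-D * τ / (|D| * -τ * |D|)) * -D = 1 := by
    field_simp
    rw [sq_abs]
  rw [this, one_smul]

section Smooth

variable {E : Type*} [NormedAddCommGroup E] [NormedSpace ℝ E] {S : Set E}

theorem contDiffOn_cross4 {a b d : E → R42} (ha : ContDiffOn ℝ ∞ a S) (hb : ContDiffOn ℝ ∞ b S)
    (hd : ContDiffOn ℝ ∞ d S) : ContDiffOn ℝ ∞ (fun x => cross4 (a x) (b x) (d x)) S := by
  have ha' := contDiffOn_pi.1 ha
  have hb' := contDiffOn_pi.1 hb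
  have hd' := contDiffOn_pi.1 hd
  have hp : ∀ i j, ContDiffOn ℝ ∞ (fun x => a x i * b x j - a x j * b x i) S := fun i j =>
    ((ha' i).mul (hb' j)).sub ((ha' j).mul (hb' i))
  rw [contDiffOn_pi]
  intro i
  fin_cases i
  · exact (((hp 1 2).mul (hd' 3)).sub ((hp 1 3).mul (hd' 2))).add ((hp 2 3).mul (hd' 1))
  · exact ((((hp 0 2).mul (hd' 3)).neg).add ((hp 0 3).mul (hd' 2))).sub ((hp 2 3).mul (hd' 0))
  · exact ((((hp 0 1).mul (hd' 3)).neg).add ((hp 0 3).mul (hd' 1))).sub ((hp 1 3).mul (hd' 0))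
  · exact (((hp 0 1).mul (hd' 2)).sub ((hp 0 2).mul (hd' 1))).add ((hp 1 2).mul (hd' 0))

theorem contDiffOn_timeField {d : E → R42} (hd : ContDiffOn ℝ ∞ d S) :
    ContDiffOn ℝ ∞ (fun x => timeField (d x)) S := by
  have hd' := contDiffOn_pi.1 hd
  rw [contDiffOn_pi]
  intro i
  fin_cases i
  · exact contDiffOn_const
  · exact contDiffOn_const
  · exact hd' 3
  · exact (hd' 2).neg

/-- Nothing is assumed on the regularity of `c`. The formula of `normal_eq` expresses it through
`a`, `b`, `d`, and its square roots are taken of positive functions. -/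
theorem contDiffOn_normal {a b c d : E → R42} (ha : ContDiffOn ℝ ∞ a S)
    (hb : ContDiffOn ℝ ∞ b S) (hd : ContDiffOn ℝ ∞ d S)
    (h : ∀ x ∈ S, AdaptedFrame (a x) (b x) (c x) (d x))
    (hf : ∀ x ∈ S, sca (c x) (timeField (d x)) < 0) : ContDiffOn ℝ ∞ c S := by
  have hN := contDiffOn_cross4 ha hb hd
  have hτ := contDiffOn_sca hN (contDiffOn_timeField hd)
  have hpos := fun x hx => (h x hx).normal_eq (hf x hx)
  have h1 := (hτ.pow 2).sqrt fun x hx => (hpos x hx).1.ne'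
  have h2 := (contDiffOn_sca hN hN).neg.sqrt fun x hx => (hpos x hx).2.1.ne'
  refine ((hτ.div (h1.mul h2) fun x hx => ?_).neg.smul hN).congr fun x hx => (hpos x hx).2.2
  exact mul_ne_zero (Real.sqrt_ne_zero'.2 (hpos x hx).1) (Real.sqrt_ne_zero'.2 (hpos x hx).2.1)

end Smooth

/-! ### Families of surfaces in coordinates -/

/-- A smooth family of spacelike surfaces in `AdS₃` with unit normals, in coordinates. -/
structure ChartFamily (S : Set (Plane × ℝ)) (u n : Plane × ℝ → R42) : Prop where
  unique : UniqueDiffOn ℝ S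
  subset : S ⊆ closure (interior S)
  smooth : ContDiffOn ℝ ∞ u S
  smooth_normal : ContDiffOn ℝ ∞ n S
  uu : ∀ z ∈ S, sca (u z) (u z) = -1
  nn : ∀ z ∈ S, sca (n z) (n z) = -1
  nu : ∀ z ∈ S, sca (n z) (u z) = 0
  normal : ∀ z ∈ S, ∀ X : Plane, sca (n z) (pd S (X, 0) u z) = 0
  pos : ∀ z ∈ S, ∀ X : Plane, X ≠ 0 → 0 < sca (pd S (X, 0) u z) (pd S (X, 0) u z)

/-- The spatial differential. -/
def spatial {V : Type*} [NormedAddCommGroup V] [NormedSpace ℝ V] (S : Set (Plane × ℝ))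
    (w : Plane × ℝ → V) (z : Plane × ℝ) : Plane →L[ℝ] V :=
  (fderivWithin ℝ w S z).comp (ContinuousLinearMap.inl ℝ Plane ℝ)

theorem spatial_apply {V : Type*} [NormedAddCommGroup V] [NormedSpace ℝ V]
    (S : Set (Plane × ℝ)) (w : Plane × ℝ → V) (z : Plane × ℝ) (X : Plane) :
    spatial S w z X = pd S (X, 0) w z := rfl

theorem sca_pd_self {S : Set (Plane × ℝ)} (hS : UniqueDiffOn ℝ S) {u : Plane × ℝ → R42}
    (hu : ContDiffOn ℝ ∞ u S) {r : ℝ} (h : ∀ z ∈ S, sca (u z) (u z) = r) {z : Plane × ℝ}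
    (hz : z ∈ S) (v : Plane × ℝ) : sca (pd S v u z) (u z) = 0 := by
  have h1 := pd_sca hS hu hu hz v
  rw [pd_congr (w' := fun _ => r) (fun x hx => h x hx) hz, pd_const, sca_comm (u z)] at h1
  linarith

namespace ChartFamily

variable {S : Set (Plane × ℝ)} {u n : Plane × ℝ → R42} {z : Plane × ℝ}

/-- Differentiate the orthogonality of `n` to the surface. A spatial `v` gives the symmetry of `h`,
the time direction the evolution of the normal. -/
theorem sca_pd_normal (h : ChartFamily S u n) (hz : z ∈ S) (v : Plane × ℝ) (X : Plane) :
    sca (pd S v n z) (pd S (X, 0) u z) = -sca (n z) (pd S v (pd S (X, 0) u) z) := by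
  have h1 := pd_sca h.unique h.smooth_normal (pd_contDiffOn h.unique h.smooth (X, 0)) hz v
  rw [pd_congr (w' := fun _ => 0) (fun x hx => h.normal x hx X) hz, pd_const] at h1
  linarith

theorem firstJet (h : ChartFamily S u n) (hz : z ∈ S) :
    FirstJet (u z) (n z) (spatial S u z) (spatial S n z) where
  FF := h.uu z hz
  nn := h.nn z hz
  nF := h.nu z hz
  aF X := sca_pd_self h.unique h.smooth h.uu hz _
  an X := by rw [sca_comm]; exact h.normal z hz X
  bF X := by
    have h1 := pd_sca h.unique h.smooth_normal h.smooth hz (X, 0)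
    rw [pd_congr (w' := fun _ => 0) (fun x hx => h.nu x hx) hz, pd_const, h.normal z hz] at h1
    rw [spatial_apply]
    linarith
  bn X := sca_pd_self h.unique h.smooth_normal h.nn hz _
  pos := h.pos z hz
  symm X Y := by
    simp only [spatial_apply]
    rw [h.sca_pd_normal hz, h.sca_pd_normal hz, pd_symm h.unique h.subset h.smooth hz]

/-- The second derivatives in the coordinate directions. -/
def second {V : Type*} [NormedAddCommGroup V] [NormedSpace ℝ V] (S : Set (Plane × ℝ))
    (w : Plane × ℝ → V) (z : Plane × ℝ) (i j : Fin 2) : V :=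
  pd S (bas i, 0) (pd S (bas j, 0) w) z

theorem secondJet (h : ChartFamily S u n) (hz : z ∈ S) :
    SecondJet (u z) (n z) (spatial S u z) (spatial S n z) (second S u z) (second S n z) where
  toFirstJet := h.firstJet hz
  symmF i j := pd_symm h.unique h.subset h.smooth hz _ _
  symmn i j := pd_symm h.unique h.subset h.smooth_normal hz _ _
  codazzi i j k := by
    -- Seen from the flat ambient space, the Codazzi equation is the `i`-th derivative of `h(e_j,
    -- e_k) = h(e_k, e_j)`.
    have hd := fun i : Fin 2 => pd_contDiffOn h.unique h.smooth (bas i, (0 : ℝ))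
    have hd' := fun i : Fin 2 => pd_contDiffOn h.unique h.smooth_normal (bas i, (0 : ℝ))
    have h1 := pd_sca h.unique (hd' j) (hd k) hz (bas i, 0)
    have h2 : EqOn (fun x => sca (pd S (bas j, 0) n x) (pd S (bas k, 0) u x))
        (fun x => sca (pd S (bas k, 0) n x) (pd S (bas j, 0) u x)) S :=
      fun x hx => (h.firstJet hx).symm (bas j) (bas k)
    rw [pd_congr h2 hz, pd_sca h.unique (hd' k) (hd j) hz] at h1
    exact h1.symm

theorem pd_gauss (h : ChartFamily S u n) (hz : z ∈ S) (v : Plane × ℝ) :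
    pd S v (fun x => bivPair (n x) (u x)) z =
      bivPair (pd S v n z) (u z) + bivPair (n z) (pd S v u z) :=
  pd_bilin bivPairL h.unique h.smooth_normal h.smooth hz v

theorem second_gauss (h : ChartFamily S u n) (hz : z ∈ S) (i j : Fin 2) :
    second S (fun x => bivPair (n x) (u x)) z i j =
      bivPair (second S n z i j) (u z) + bivPair (spatial S n z (bas j)) (spatial S u z (bas i)) +
      (bivPair (spatial S n z (bas i)) (spatial S u z (bas j)) +
        bivPair (n z) (second S u z i j)) := by
  have hd := pd_contDiffOn h.unique h.smooth (bas j, (0 : ℝ))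
  have hd' := pd_contDiffOn h.unique h.smooth_normal (bas j, (0 : ℝ))
  rw [second, pd_congr (fun x hx => h.pd_gauss hx (bas j, 0)) hz]
  refine (pd_add h.unique (contDiffOn_bilin bivPairL hd' h.smooth)
    (contDiffOn_bilin bivPairL h.smooth_normal hd) hz _).trans ?_
  exact congrArg₂ _ (pd_bilin bivPairL h.unique hd' h.smooth hz _)
    (pd_bilin bivPairL h.unique h.smooth_normal hd hz _)

/-- The variation of the unit normal. -/
theorem velocity_normal (h : ChartFamily S u n) {f : Plane × ℝ → ℝ} (hf : ContDiffOn ℝ ∞ f S)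
    {v : Plane × ℝ} (hv : ∀ z ∈ S, pd S v u z = f z • n z) (hz : z ∈ S) :
    sca (pd S v n z) (u z) = f z ∧ sca (pd S v n z) (n z) = 0 ∧
      ∀ X, sca (pd S v n z) (spatial S u z X) = spatial S f z X := by
  refine ⟨?_, sca_pd_self h.unique h.smooth_normal h.nn hz _, fun X => ?_⟩
  · have h1 := pd_sca h.unique h.smooth_normal h.smooth hz v
    rw [pd_congr (w' := fun _ => 0) (fun x hx => h.nu x hx) hz, pd_const, hv z hz,
      sca_smul_right, h.nn z hz] at h1
    linarith
  -- After exchanging the derivatives in the directions `v` and `X`, only the derivative of `f`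
  -- survives, because `n` has constant square `-1`.
  · rw [spatial_apply, h.sca_pd_normal hz, pd_symm h.unique h.subset h.smooth hz,
      pd_congr (w' := fun x => f x • n x) hv hz]
    have h1 : pd S (X, 0) (fun x => f x • n x) z =
        pd S (X, 0) f z • n z + f z • pd S (X, 0) n z :=
      pd_bilin (ContinuousLinearMap.lsmul ℝ ℝ) h.unique hf h.smooth_normal hz _
    rw [h1, sca_add_right, sca_smul_right, sca_smul_right, h.nn z hz, sca_comm (n z),
      sca_pd_self h.unique h.smooth_normal h.nn hz]
    rw [spatial_apply]; ring

theorem contDiffOn_angleRe_spatial (h : ChartFamily S u n) : ContDiffOn ℝ ∞ (fun z =>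
    angleRe (spatial S u z (bas 0)) (spatial S u z (bas 1)) (spatial S n z (bas 0))
      (spatial S n z (bas 1))) S :=
  contDiffOn_angleRe (pd_contDiffOn h.unique h.smooth _) (pd_contDiffOn h.unique h.smooth _)
    (pd_contDiffOn h.unique h.smooth_normal _) (pd_contDiffOn h.unique h.smooth_normal _)

theorem contDiffOn_angleIm_spatial (h : ChartFamily S u n) : ContDiffOn ℝ ∞ (fun z =>
    angleIm (spatial S u z (bas 0)) (spatial S u z (bas 1)) (spatial S n z (bas 0))
      (spatial S n z (bas 1))) S :=
  contDiffOn_angleIm (pd_contDiffOn h.unique h.smooth _) (pd_contDiffOn h.unique h.smooth _)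
    (pd_contDiffOn h.unique h.smooth_normal _) (pd_contDiffOn h.unique h.smooth_normal _)

theorem contDiffOn_angle (h : ChartFamily S u n) : ContDiffOn ℝ ∞ (fun z =>
    (angle (spatial S u z (bas 0)) (spatial S u z (bas 1)) (spatial S n z (bas 0))
      (spatial S n z (bas 1))).arg) S :=
  contDiffOn_arg h.contDiffOn_angleRe_spatial h.contDiffOn_angleIm_spatial
    fun _ hz => (h.firstJet hz).angle_mem_slitPlane

theorem pd_angle (h : ChartFamily S u n) (hz : z ∈ S) (k : Fin 2) :
    pd S (bas k, 0) (fun z => (angle (spatial S u z (bas 0)) (spatial S u z (bas 1))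
      (spatial S n z (bas 0)) (spatial S n z (bas 1))).arg) z =
    argDeriv (angleRe (spatial S u z (bas 0)) (spatial S u z (bas 1)) (spatial S n z (bas 0))
        (spatial S n z (bas 1)))
      (angleIm (spatial S u z (bas 0)) (spatial S u z (bas 1)) (spatial S n z (bas 0))
        (spatial S n z (bas 1)))
      (dAngleRe (spatial S u z) (spatial S n z) (second S u z) (second S n z) k)
      (dAngleIm (spatial S u z) (spatial S n z) (second S u z) (second S n z) k) := by
  refine (pd_arg h.unique h.contDiffOn_angleRe_spatial h.contDiffOn_angleIm_spatial hz
    (h.firstJet hz).angle_mem_slitPlane _).trans ?_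
  have hd := fun i : Fin 2 => pd_contDiffOn h.unique h.smooth (bas i, (0 : ℝ))
  have hd' := fun i : Fin 2 => pd_contDiffOn h.unique h.smooth_normal (bas i, (0 : ℝ))
  have hg := fun i j => contDiffOn_sca (hd i) (hd j)
  have hh := fun i j => contDiffOn_sca (hd' i) (hd j)
  have dg := fun i j => pd_sca h.unique (hd i) (hd j) hz (bas k, 0)
  have dh := fun i j => pd_sca h.unique (hd' i) (hd j) hz (bas k, 0)
  congr 1
  · simp only [angleRe, spatial_apply, sq, dAngleRe]
    rw [pd_sub h.unique (((hg 0 0).mul (hg 1 1)).sub ((hg 0 1).mul (hg 0 1)))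
        (((hh 0 0).mul (hh 1 1)).sub ((hh 0 1).mul (hh 0 1))) hz,
      pd_sub h.unique ((hg 0 0).mul (hg 1 1)) ((hg 0 1).mul (hg 0 1)) hz,
      pd_sub h.unique ((hh 0 0).mul (hh 1 1)) ((hh 0 1).mul (hh 0 1)) hz,
      pd_mul h.unique (hg 0 0) (hg 1 1) hz, pd_mul h.unique (hg 0 1) (hg 0 1) hz,
      pd_mul h.unique (hh 0 0) (hh 1 1) hz, pd_mul h.unique (hh 0 1) (hh 0 1) hz]
    simp only [dg, dh, second]
    ring
  · simp only [angleIm, spatial_apply, dAngleIm]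
    rw [pd_sub h.unique (((hg 0 0).mul (hh 1 1)).add ((hg 1 1).mul (hh 0 0)))
        (contDiffOn_const.mul ((hg 0 1).mul (hh 0 1))) hz,
      pd_add h.unique ((hg 0 0).mul (hh 1 1)) ((hg 1 1).mul (hh 0 0)) hz,
      pd_mul h.unique (hg 0 0) (hh 1 1) hz, pd_mul h.unique (hg 1 1) (hh 0 0) hz,
      pd_mul h.unique contDiffOn_const ((hg 0 1).mul (hh 0 1)) hz,
      pd_mul h.unique (hg 0 1) (hh 0 1) hz, pd_const]
    simp only [dg, dh, second]
    ring

end ChartFamily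

/-! ### The Gauss maps of a family of surfaces -/

section Family

variable {M : Type*} [TopologicalSpace M] [ChartedSpace (EuclideanSpace ℝ (Fin 2)) M]
  [IsManifold (𝓡 2) ∞ M] {T : ℝ} {F ν : M → ℝ → R42}

theorem SpacelikeFamily.pos_chart (hF : SpacelikeFamily T F) (p : M) {z : Plane × ℝ}
    (hz : z ∈ chartDom p T) (X : Plane) (hX : X ≠ 0) :
    0 < sca (pd (chartDom p T) (X, 0) (inChart p F) z)
      (pd (chartDom p T) (X, 0) (inChart p F) z) := by
  obtain ⟨A, hA, hd⟩ := exists_basis_change p hz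
  rw [hd F hF.smooth]
  exact hF.spacelike _ z.2 hz.2 _ fun h => hX (hA.1 (h.trans (map_zero A).symm))

theorem SpacelikeFamily.normal_chart (hF : SpacelikeFamily T F)
    (hν : ∀ p, ∀ t ∈ Ico 0 T, IsFutureNormal (fun q => F q t) p (ν p t)) (p : M)
    {z : Plane × ℝ} (hz : z ∈ chartDom p T) (X : Plane) :
    sca (inChart p ν z) (pd (chartDom p T) (X, 0) (inChart p F) z) = 0 := by
  obtain ⟨A, -, hd⟩ := exists_basis_change p hz
  rw [hd F hF.smooth]
  exact (hν _ z.2 hz.2).normal _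

theorem SpacelikeFamily.smooth_normal (hF : SpacelikeFamily T F)
    (hν : ∀ p, ∀ t ∈ Ico 0 T, IsFutureNormal (fun q => F q t) p (ν p t)) :
    SmoothFamily T ν := by
  refine SmoothFamily.of_contDiffOn fun p => ?_
  have hS := uniqueDiffOn_chartDom p T
  have hu := hF.smooth.contDiffOn p
  refine contDiffOn_normal (pd_contDiffOn hS hu (bas 0, 0)) (pd_contDiffOn hS hu (bas 1, 0)) hu
    (fun z hz => ?_) fun z hz => (hν _ z.2 hz.2).future
  exact adaptedFrame_of (a := spatial (chartDom p T) (inChart p F) z)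
    (hF.mem_AdS3 _ z.2 hz.2) (hν _ z.2 hz.2).unit (hν _ z.2 hz.2).tangent_AdS3
    (fun X => sca_pd_self hS hu (fun z hz => hF.mem_AdS3 _ z.2 hz.2) hz _)
    (fun X => (sca_comm _ _).trans (hF.normal_chart hν p hz X)) (hF.pos_chart p hz)

theorem SpacelikeFamily.chartFamily (hF : SpacelikeFamily T F) (hT : 0 < T)
    (hν : ∀ p, ∀ t ∈ Ico 0 T, IsFutureNormal (fun q => F q t) p (ν p t)) (p : M) :
    ChartFamily (chartDom p T) (inChart p F) (inChart p ν) where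
  unique := uniqueDiffOn_chartDom p T
  subset := chartDom_subset p hT
  smooth := hF.smooth.contDiffOn p
  smooth_normal := (hF.smooth_normal hν).contDiffOn p
  uu z hz := hF.mem_AdS3 _ z.2 hz.2
  nn z hz := (hν _ z.2 hz.2).unit
  nu z hz := (hν _ z.2 hz.2).tangent_AdS3
  normal _ hz := hF.normal_chart hν p hz
  pos _ hz := hF.pos_chart p hz

theorem SmoothFamily.diff_eq_spatial {V : Type*} [NormedAddCommGroup V] [NormedSpace ℝ V]
    {w : M → ℝ → V} (hw : SmoothFamily T w) (p : M) {t : ℝ} (ht : t ∈ Ico 0 T) :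
    diff (fun q => w q t) p = spatial (chartDom p T) (inChart p w) (extChartAt (𝓡 2) p p, t) :=
  ContinuousLinearMap.ext fun X => hw.diff_eq p ht X

theorem SpacelikeFamily.firstJet (hF : SpacelikeFamily T F) (hT : 0 < T)
    (hν : ∀ p, ∀ t ∈ Ico 0 T, IsFutureNormal (fun q => F q t) p (ν p t)) (p : M) {t : ℝ}
    (ht : t ∈ Ico 0 T) :
    FirstJet (F p t) (ν p t) (diff (fun q => F q t) p) (diff (fun q => ν q t) p) := by
  have := (hF.chartFamily hT hν p).firstJet (mem_chartDom p ht)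
  rwa [inChart_self, inChart_self, ← hF.smooth.diff_eq_spatial p ht,
    ← (hF.smooth_normal hν).diff_eq_spatial p ht] at this

theorem SpacelikeFamily.gaussMap_eq (hF : SpacelikeFamily T F) (hT : 0 < T)
    (hν : ∀ p, ∀ t ∈ Ico 0 T, IsFutureNormal (fun q => F q t) p (ν p t)) (p : M) {t : ℝ}
    (ht : t ∈ Ico 0 T) :
    gaussMap (fun q => F q t) (fun q => ν q t) p = bivPair (ν p t) (F p t) :=
  AdSGauss.gaussMap_eq (hF.firstJet hT hν p ht).adaptedFrame

/-- The angle at a point is computed in that point's own preferred chart, whereas derivatives are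
taken in the fixed chart at `p`. The change of basis multiplies `det(g + ih)` by the square of a
real determinant, so the argument is unchanged. -/
theorem SpacelikeFamily.lagrangianAngle_chart (hF : SpacelikeFamily T F) (hT : 0 < T)
    (hν : ∀ p, ∀ t ∈ Ico 0 T, IsFutureNormal (fun q => F q t) p (ν p t)) (p : M)
    {z : Plane × ℝ} (hz : z ∈ chartDom p T) :
    lagrangianAngle (fun q => F q z.2) (fun q => ν q z.2) ((extChartAt (𝓡 2) p).symm z.1) =
      (angle (spatial (chartDom p T) (inChart p F) z (bas 0))
        (spatial (chartDom p T) (inChart p F) z (bas 1))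
        (spatial (chartDom p T) (inChart p ν) z (bas 0))
        (spatial (chartDom p T) (inChart p ν) z (bas 1))).arg := by
  obtain ⟨A, -, hd⟩ := exists_basis_change p hz
  have hJ := hF.firstJet hT hν ((extChartAt (𝓡 2) p).symm z.1) hz.2
  have h0 := ((hF.chartFamily hT hν p).firstJet hz).angle_mem_slitPlane
  rw [lagrangianAngle_eq hJ]
  simp only [spatial_apply, hd F hF.smooth, hd ν (hF.smooth_normal hν)] at h0 ⊢
  rw [hJ.angle_comp (A (bas 0)) (A (bas 1))] at h0 ⊢
  -- The determinant is nonzero, since otherwise `det(g + ih)` in the fixed chart would vanish and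
  -- leave the slit plane.
  refine (Complex.arg_real_mul _ (sq_pos_of_ne_zero fun h => ?_)).symm
  rw [h, sq, zero_mul, Complex.ofReal_zero, zero_mul] at h0
  exact Complex.slitPlane_ne_zero h0 rfl

variable {G : M → ℝ → R31 × R31}

theorem SpacelikeFamily.inChart_gauss (hF : SpacelikeFamily T F) (hT : 0 < T)
    (hν : ∀ p, ∀ t ∈ Ico 0 T, IsFutureNormal (fun q => F q t) p (ν p t))
    (hG : ∀ p t, G p t = gaussMap (fun q => F q t) (fun q => ν q t) p) (p : M) :
    EqOn (inChart p G) (fun z => bivPair (inChart p ν z) (inChart p F z)) (chartDom p T) :=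
  fun _ hz => (hG _ _).trans (hF.gaussMap_eq hT hν _ hz.2)

theorem SpacelikeFamily.smooth_gauss (hF : SpacelikeFamily T F) (hT : 0 < T)
    (hν : ∀ p, ∀ t ∈ Ico 0 T, IsFutureNormal (fun q => F q t) p (ν p t))
    (hG : ∀ p t, G p t = gaussMap (fun q => F q t) (fun q => ν q t) p) : SmoothFamily T G :=
  SmoothFamily.of_contDiffOn fun p =>
    (contDiffOn_bilin bivPairL ((hF.smooth_normal hν).contDiffOn p)
      (hF.smooth.contDiffOn p)).congr (hF.inChart_gauss hT hν hG p)

theorem SpacelikeFamily.gauss_mem_Gr (hF : SpacelikeFamily T F) (hT : 0 < T)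
    (hν : ∀ p, ∀ t ∈ Ico 0 T, IsFutureNormal (fun q => F q t) p (ν p t))
    (hG : ∀ p t, G p t = gaussMap (fun q => F q t) (fun q => ν q t) p) (p : M) {t : ℝ}
    (ht : t ∈ Ico 0 T) : G p t ∈ Gr := by
  rw [hG, hF.gaussMap_eq hT hν p ht]
  have h := hν p t ht
  exact bivPair_mem_Gr h.unit (hF.mem_AdS3 p t ht) h.tangent_AdS3 h.future

theorem SpacelikeFamily.diff_gauss (hF : SpacelikeFamily T F) (hT : 0 < T)
    (hν : ∀ p, ∀ t ∈ Ico 0 T, IsFutureNormal (fun q => F q t) p (ν p t))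
    (hG : ∀ p t, G p t = gaussMap (fun q => F q t) (fun q => ν q t) p) (p : M) {t : ℝ}
    (ht : t ∈ Ico 0 T) (X : Plane) : diff (fun q => G q t) p X =
      bivPair (diff (fun q => ν q t) p X) (F p t) +
        bivPair (ν p t) (diff (fun q => F q t) p X) := by
  have hz := mem_chartDom p ht
  rw [(hF.smooth_gauss hT hν hG).diff_eq p ht, pd_congr (hF.inChart_gauss hT hν hG p) hz,
    (hF.chartFamily hT hν p).pd_gauss hz, inChart_self, inChart_self,
    hF.smooth.diff_eq p ht, (hF.smooth_normal hν).diff_eq p ht]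

theorem SpacelikeFamily.diff2_gauss (hF : SpacelikeFamily T F) (hT : 0 < T)
    (hν : ∀ p, ∀ t ∈ Ico 0 T, IsFutureNormal (fun q => F q t) p (ν p t))
    (hG : ∀ p t, G p t = gaussMap (fun q => F q t) (fun q => ν q t) p) (p : M) {t : ℝ}
    (ht : t ∈ Ico 0 T) (i j : Fin 2) : diff2 (fun q => G q t) p i j =
      bivPair (diff2 (fun q => ν q t) p i j) (F p t) +
        bivPair (diff (fun q => ν q t) p (bas j)) (diff (fun q => F q t) p (bas i)) +
      (bivPair (diff (fun q => ν q t) p (bas i)) (diff (fun q => F q t) p (bas j)) +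
        bivPair (ν p t) (diff2 (fun q => F q t) p i j)) := by
  have hz := mem_chartDom p ht
  have h1 : EqOn (pd (chartDom p T) (bas j, 0) (inChart p G))
      (pd (chartDom p T) (bas j, 0) fun z => bivPair (inChart p ν z) (inChart p F z))
      (chartDom p T) := fun z hz => pd_congr (hF.inChart_gauss hT hν hG p) hz _
  rw [(hF.smooth_gauss hT hν hG).diff2_eq p ht, pd_congr h1 hz]
  refine ((hF.chartFamily hT hν p).second_gauss hz i j).trans ?_
  rw [inChart_self, inChart_self, ← hF.smooth.diff_eq_spatial p ht,
    ← (hF.smooth_normal hν).diff_eq_spatial p ht, hF.smooth.diff2_eq p ht,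
    (hF.smooth_normal hν).diff2_eq p ht]
  rfl

theorem SpacelikeFamily.secondJet (hF : SpacelikeFamily T F) (hT : 0 < T)
    (hν : ∀ p, ∀ t ∈ Ico 0 T, IsFutureNormal (fun q => F q t) p (ν p t)) (p : M) {t : ℝ}
    (ht : t ∈ Ico 0 T) :
    SecondJet (F p t) (ν p t) (diff (fun q => F q t) p) (diff (fun q => ν q t) p)
      (diff2 (fun q => F q t) p) (diff2 (fun q => ν q t) p) := by
  have := (hF.chartFamily hT hν p).secondJet (mem_chartDom p ht)
  rw [inChart_self, inChart_self, ← hF.smooth.diff_eq_spatial p ht,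
    ← (hF.smooth_normal hν).diff_eq_spatial p ht] at this
  convert this using 1
  · ext i j : 2
    exact hF.smooth.diff2_eq p ht i j
  · ext i j : 2
    exact (hF.smooth_normal hν).diff2_eq p ht i j

/-- The evolution of the Gauss map under a normal variation. -/
theorem SpacelikeFamily.hasVelocity_gauss (hF : SpacelikeFamily T F) (hT : 0 < T)
    (hν : ∀ p, ∀ t ∈ Ico 0 T, IsFutureNormal (fun q => F q t) p (ν p t))
    (hG : ∀ p t, G p t = gaussMap (fun q => F q t) (fun q => ν q t) p)
    {f : M → ℝ → ℝ} (hf : SmoothFamily T f)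
    (hv : ∀ p, ∀ t ∈ Ico 0 T, HasVelocity T (F p) t (f p t • ν p t)) (p : M) {t : ℝ}
    (ht : t ∈ Ico 0 T) :
    HasVelocity T (G p) t
      (grJ (G p t) (diff (fun q => G q t) p (grad (fun q => G q t) (fun q => f q t) p)) +
        diff (fun q => G q t) p (weingarten (fun q => F q t) (fun q => ν q t) p
          (grad (fun q => G q t) (fun q => f q t) p))) := by
  have hz := mem_chartDom p ht
  have hC := hF.chartFamily hT hν p
  -- The equation is needed on the whole chart domain and not only at `p`, because it is
  -- differentiated in space to find the variation of the normal.
  have hv' : ∀ z ∈ chartDom p T, pd (chartDom p T) (0, 1) (inChart p F) z =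
      inChart p f z • inChart p ν z := fun z hz =>
    (hF.smooth.hasVelocity p hz).unique hz.2 (hv _ z.2 hz.2)
  obtain ⟨h1, h2, h3⟩ := hC.velocity_normal (hf.contDiffOn p) hv' hz
  rw [inChart_self] at h1 h2
  rw [inChart_self] at h1
  rw [← hF.smooth.diff_eq_spatial p ht, ← hf.diff_eq_spatial p ht] at h3
  have hvar := (hF.firstJet hT hν p ht).variation (hF.diff_gauss hT hν hG p ht) _ h1 h2 h3
  have hvel := (hF.smooth_gauss hT hν hG).hasVelocity p hz
  rw [pd_congr (hF.inChart_gauss hT hν hG p) hz, hC.pd_gauss hz, hv' _ hz, inChart_self,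
    inChart_self, inChart_self] at hvel
  simp only [extChartAt_to_inv] at hvel
  rw [hvar, ← hF.gaussMap_eq hT hν p ht, ← hG] at hvel
  exact hvel

theorem SpacelikeFamily.isLagrangianImmersion (hF : SpacelikeFamily T F) (hT : 0 < T)
    (hν : ∀ p, ∀ t ∈ Ico 0 T, IsFutureNormal (fun q => F q t) p (ν p t))
    (hG : ∀ p t, G p t = gaussMap (fun q => F q t) (fun q => ν q t) p) {t : ℝ}
    (ht : t ∈ Ico 0 T) : IsLagrangianImmersion (fun q => G q t) where
  smooth := (hF.smooth_gauss hT hν hG).slice ht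
  mem_Gr p := hF.gauss_mem_Gr hT hν hG p ht
  immersion p := by
    rw [injective_iff_map_eq_zero]
    intro X hX
    by_contra h0
    have := (hF.firstJet hT hν p ht).induced_pos (hF.diff_gauss hT hν hG p ht) X h0
    rw [hX] at this
    simp [grMetric, mink] at this
  lagrangian p X Y := by
    rw [grKahler, hG p t, hF.gaussMap_eq hT hν p ht]
    exact (hF.firstJet hT hν p ht).lagrangian (hF.diff_gauss hT hν hG p ht) X Y

variable {φ : M → ℝ → ℝ}

theorem SpacelikeFamily.inChart_angle (hF : SpacelikeFamily T F) (hT : 0 < T)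
    (hν : ∀ p, ∀ t ∈ Ico 0 T, IsFutureNormal (fun q => F q t) p (ν p t))
    (hφ : ∀ p t, φ p t = lagrangianAngle (fun q => F q t) (fun q => ν q t) p) (p : M) :
    EqOn (inChart p φ) (fun z => (angle (spatial (chartDom p T) (inChart p F) z (bas 0))
        (spatial (chartDom p T) (inChart p F) z (bas 1))
        (spatial (chartDom p T) (inChart p ν) z (bas 0))
        (spatial (chartDom p T) (inChart p ν) z (bas 1))).arg) (chartDom p T) :=
  fun _ hz => (hφ _ _).trans (hF.lagrangianAngle_chart hT hν p hz)

theorem SpacelikeFamily.smooth_angle (hF : SpacelikeFamily T F) (hT : 0 < T)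
    (hν : ∀ p, ∀ t ∈ Ico 0 T, IsFutureNormal (fun q => F q t) p (ν p t))
    (hφ : ∀ p t, φ p t = lagrangianAngle (fun q => F q t) (fun q => ν q t) p) :
    SmoothFamily T φ :=
  SmoothFamily.of_contDiffOn fun p => (hF.chartFamily hT hν p).contDiffOn_angle.congr
    (hF.inChart_angle hT hν hφ p)

/-- The mean curvature vector of the Gauss map is the rotated gradient of the Lagrangian angle. -/
theorem SpacelikeFamily.meanCurvature_gauss (hF : SpacelikeFamily T F) (hT : 0 < T)
    (hν : ∀ p, ∀ t ∈ Ico 0 T, IsFutureNormal (fun q => F q t) p (ν p t))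
    (hG : ∀ p t, G p t = gaussMap (fun q => F q t) (fun q => ν q t) p)
    (hφ : ∀ p t, φ p t = lagrangianAngle (fun q => F q t) (fun q => ν q t) p) (p : M) {t : ℝ}
    (ht : t ∈ Ico 0 T) : meanCurvature (fun q => G q t) p =
      grJ (G p t) (diff (fun q => G q t) p (grad (fun q => G q t) (fun q => φ q t) p)) := by
  have hz := mem_chartDom p ht
  have hJ := hF.secondJet hT hν p ht
  have hc := hF.diff_gauss hT hν hG p ht
  have hℓ : ∀ k, diff (fun q => φ q t) p (bas k) = ∑ i, ∑ j,
      (coeff fun X Y => grMetric (diff (fun q => G q t) p X) (diff (fun q => G q t) p Y))⁻¹ i j *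
        cubicForm (diff (fun q => F q t) p) (diff (fun q => ν q t) p)
          (diff2 (fun q => F q t) p) (diff2 (fun q => ν q t) p) k i j := by
    intro k
    rw [← hJ.argDeriv_eq hc]
    rw [(hF.smooth_angle hT hν hφ).diff_eq p ht,
      pd_congr (hF.inChart_angle hT hν hφ p) hz]
    refine ((hF.chartFamily hT hν p).pd_angle hz k).trans ?_
    have e1 : ChartFamily.second (chartDom p T) (inChart p F) (extChartAt (𝓡 2) p p, t) =
        diff2 (fun q => F q t) p := by
      ext i j : 2
      exact (hF.smooth.diff2_eq p ht i j).symm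
    have e2 : ChartFamily.second (chartDom p T) (inChart p ν) (extChartAt (𝓡 2) p p, t) =
        diff2 (fun q => ν q t) p := by
      ext i j : 2
      exact ((hF.smooth_normal hν).diff2_eq p ht i j).symm
    rw [← hF.smooth.diff_eq_spatial p ht, ← (hF.smooth_normal hν).diff_eq_spatial p ht, e1, e2]
  have key := hJ.meanCurvature_eq hc (diff (fun q => φ q t) p) hℓ (hF.diff2_gauss hT hν hG p ht)
  rw [← hF.gaussMap_eq hT hν p ht, ← hG] at key
  exact key

end Family

end AdSGauss

end

theorem lemmaA3 {M : Type*} [TopologicalSpace M] [ChartedSpace (EuclideanSpace ℝ (Fin 2)) M]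
    [IsManifold (𝓡 2) ∞ M] (T : ℝ) (hT : 0 < T) (F ν : M → ℝ → AdSGauss.R42)
    (hF : AdSGauss.SpacelikeFamily T F)
    (hν : ∀ p, ∀ t ∈ Set.Ico 0 T,
      AdSGauss.IsFutureNormal (fun q => F q t) p (ν p t))
    (G : M → ℝ → AdSGauss.R31 × AdSGauss.R31)
    (hG : ∀ p t, G p t = AdSGauss.gaussMap (fun q => F q t) (fun q => ν q t) p)
    (W : ℝ → M → AdSGauss.Plane → AdSGauss.Plane)
    (hW : ∀ t p, W t p = AdSGauss.weingarten (fun q => F q t) (fun q => ν q t) p)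
    (φ : M → ℝ → ℝ)
    (hφ : ∀ p t, φ p t = AdSGauss.lagrangianAngle (fun q => F q t) (fun q => ν q t) p) :
    AdSGauss.SmoothFamily T G ∧
    (∀ p, ∀ t ∈ Set.Ico 0 T, G p t ∈ AdSGauss.Gr) ∧
    (∀ f : M → ℝ → ℝ, AdSGauss.SmoothFamily T f →
      (∀ p, ∀ t ∈ Set.Ico 0 T, AdSGauss.HasVelocity T (F p) t (f p t • ν p t)) →
      ∀ p, ∀ t ∈ Set.Ico 0 T,
        AdSGauss.HasVelocity T (G p) t
          (AdSGauss.grJ (G p t)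
              (AdSGauss.diff (fun q => G q t) p
                (AdSGauss.grad (fun q => G q t) (fun q => f q t) p)) +
            AdSGauss.diff (fun q => G q t) p
              (W t p (AdSGauss.grad (fun q => G q t) (fun q => f q t) p)))) ∧
    ((∀ p, ∀ t ∈ Set.Ico 0 T, AdSGauss.HasVelocity T (F p) t (φ p t • ν p t)) →
      AdSGauss.SmoothFamily T φ ∧
      ∀ t ∈ Set.Ico 0 T,
        AdSGauss.IsLagrangianImmersion (fun q => G q t) ∧
        ∀ p, AdSGauss.HasVelocity T (G p) t
          (AdSGauss.meanCurvature (fun q => G q t) p +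
            AdSGauss.diff (fun q => G q t) p
              (W t p (AdSGauss.grad (fun q => G q t) (fun q => φ q t) p)))) := by
  refine ⟨hF.smooth_gauss hT hν hG, fun p t ht => hF.gauss_mem_Gr hT hν hG p ht,
    fun f hf hv p t ht => ?_, fun hv => ?_⟩
  · rw [hW]
    exact hF.hasVelocity_gauss hT hν hG hf hv p ht
  -- Smoothness of `φ` does not depend on the flow. With it and `H = J dG(∇φ)`, the second assertion
  -- is the first one for `f = φ`.
  · have hs := hF.smooth_angle hT hν hφ
    refine ⟨hs, fun t ht => ⟨hF.isLagrangianImmersion hT hν hG ht, fun p => ?_⟩⟩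
    rw [hW, hF.meanCurvature_gauss hT hν hG hφ p ht]
    exact hF.hasVelocity_gauss hT hν hG hs hv p ht
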